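/- Let $G$ be a finite simple graph. For an edge-coloring of $G$, call it strong if any two distinct edges that share an end vertex, or that are joined by an edge of $G$, receive different colors; the strong chromatic index $\chi'_s(G)$ is the least $k$ such that $G$ has a strong edge-coloring with $k$ colors. Let $\sigma=\sigma(G)=\max_{xy\in E(G)}\{\deg(x)+\deg(y)-1\}$, let the odd girth of $G$ be the length of a shortest odd cycle ($\infty$ if there is none), and let $\operatorname{mad}(G)=\max_{H\subseteq G,\,V(H)\ne\emptyset}\frac{2|E(H)|}{|V(H)|}$ be the maximum average degree. Put $$\ell_{s}=\begin{cases}8,&\text{if } s=5;\\ 7,&\text{if } s=6,7;\\ s,&\text{if } s\ge 8.\end{cases}$$ Theorem. If $\sigma\ge 4$, the odd girth of $G$ is at least $\frac{\sigma+1}{2}$, and $\operatorname{mad}(G)<2+\frac{2}{3\ell_{\sigma+1}-1}$, then $$\sigma\le\chi'_s(G)\le\sigma+1.$$ -/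

import Mathlib

namespace SimpleGraph

/-- A strong edge-coloring: distinct edges at distance at most two (measured in the line graph, so
that edges sharing an end vertex are at distance one) receive different colors. -/
def IsStrongEdgeColoring {V C : Type*} (G : SimpleGraph V) (c : G.edgeSet → C) : Prop :=
  ∀ e f : G.edgeSet, e ≠ f → G.lineGraph.edist e f ≤ 2 → c e ≠ c f

/-- `G` has a strong `k`-edge-coloring. -/
def StrongEdgeColorable {V : Type*} (G : SimpleGraph V) (k : ℕ) : Prop :=
  ∃ c : G.edgeSet → Fin k, G.IsStrongEdgeColoring c

/-- The strong chromatic index: the least `k` such that `G` has a strong `k`-edge-coloring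
(`⊤` if there is none). -/
noncomputable def strongChromaticIndex {V : Type*} (G : SimpleGraph V) : ℕ∞ :=
  ⨅ k : ℕ, ⨅ _ : G.StrongEdgeColorable k, (k : ℕ∞)

open Classical in
/-- `σ(G)`, the maximum of `deg x + deg y - 1` over the edges `xy` of `G`
(`0` if `G` has no edge). -/
noncomputable def sigma {V : Type*} [Fintype V] (G : SimpleGraph V) : ℕ :=
  (Finset.univ : Finset G.Dart).sup fun e => G.degree e.fst + G.degree e.snd - 1

/-- The odd girth: the least length of an odd cycle (`⊤` if there is none). -/
noncomputable def oddGirth {V : Type*} (G : SimpleGraph V) : ℕ∞ :=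
  ⨅ a : V, ⨅ w : G.Walk a a, ⨅ _ : w.IsCycle ∧ Odd w.length, (w.length : ℕ∞)

/-- The maximum average degree: the maximum of `2|E(H)| / |V(H)|` over the subgraphs `H` of `G` with
at least one vertex. -/
noncomputable def mad {V : Type*} [Fintype V] (G : SimpleGraph V) : ℝ :=
  ⨆ H : {H : G.Subgraph // H.verts.Nonempty},
    2 * (H.1.edgeSet.ncard : ℝ) / (H.1.verts.ncard : ℝ)

end SimpleGraph

/-- The number `ℓ_s`, meaningful for `s ≥ 5`: `8` if `s = 5`, `7` if `s = 6, 7`, and `s` if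
`s ≥ 8`. -/
def threadLength (s : ℕ) : ℕ :=
  if s = 5 then 8 else if s = 6 ∨ s = 7 then 7 else s

/-! Put s = σ + 1 and call the set of colors on the edges at a vertex its palette. A coloring is
strong when the edges at each vertex have distinct colors and the palettes of adjacent vertices
share only the color of the edge joining them. Pendant edges then matter only through palette sizes:
once palettes and the colors of the non-pendant edges are chosen, the unused palette colors go to
the leaves (`exists_strongPairColoring_of_palettes`). The only numerical constraint is deg x + deg y
≤ s on edges.

The upper bound is by induction over subgraphs with s fixed. The core consists of the edges between
vertices of degree at least two. A vertex of degree at least two with at most one core neighbor is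
handled directly. Otherwise the core has minimum degree two on these vertices, and a dart count with
the density bound yields l consecutive vertices of core degree two (`exists_long_thread`), which
either contain a cycle or form a thread (`cycle_or_thread`).

On a thread, each palette lies in the complement of its predecessor except for one color.
Alternating complements of the far palette give moving targets, and each vertex corrects one error;
after about s/2 vertices the remaining few can be fitted exactly (`exists_palettes_thread`). Cycles
are solved explicitly (`cyclePalettes`): even ones by alternating two color reserves, odd ones by
induction on the number of colors down to a vertex of degree two or to constant degree. Odd girth is
needed only there.

The lower bound holds because all edges meeting an edge that attains σ are pairwise within distance
two in the line graph (`sigma_le_of_strongEdgeColorable`). -/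

open Finset in
-- A greedy choice that takes colors of `Y` first either never leaves `Y` or exhausts `U ∩ Y`.
theorem exists_subset_card_eq_preferring {C : Type*} [DecidableEq C] (U Y : Finset C) {m : ℕ}
    (hm : m ≤ #U) : ∃ R ⊆ U, #R = m ∧ (R ⊆ Y ∨ U ∩ Y ⊆ R) := by
  by_cases h : m ≤ #(U ∩ Y)
  · obtain ⟨R, hR, hc⟩ := exists_subset_card_eq h
    exact ⟨R, hR.trans inter_subset_left, hc, Or.inl (hR.trans inter_subset_right)⟩
  · obtain ⟨R, h1, h2, h3⟩ := exists_subsuperset_card_eq (inter_subset_left : U ∩ Y ⊆ U)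
      (by omega : #(U ∩ Y) ≤ m) hm
    exact ⟨R, h2, h3, Or.inr h1⟩

/-! ### Single steps along a thread -/

section ThreadSteps

open Finset

variable {C : Type*} [Fintype C] [DecidableEq C]

/-- Passing to complements exchanges the two differences from the target. Spending the shared color
`e` on an element of `E \ X` and filling up from `Xᶜ` first makes one error disappear. The color
`ep` is that of the preceding edge, which `e` must avoid. -/
theorem exists_palette_step (E X : Finset C) (ep : C) (d k : ℕ) (hE : 2 ≤ #E) (hd : 2 ≤ d)
    (h : #E + d ≤ Fintype.card C) (hX : #(E \ X) ≤ k + 2 ∨ #(X \ E) ≤ k + 2) :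
    ∃ (e : C) (E' : Finset C), e ≠ ep ∧ E ∩ E' = {e} ∧ #E' = d ∧
      (#(E' \ Xᶜ) ≤ k + 1 ∨ #(Xᶜ \ E') ≤ k + 1) := by
  have hU : d ≤ #Eᶜ := by rw [card_compl]; omega
  obtain ⟨R, hRU, hRc, hR⟩ := exists_subset_card_eq_preferring Eᶜ Xᶜ (m := d - 1) (by omega)
  have key : ∀ e ∈ E, E ∩ insert e R = {e} ∧ #(insert e R) = d := by
    intro e he
    have hdis : ∀ x ∈ R, x ∉ E := fun x hx => by simpa using hRU hx
    refine ⟨?_, ?_⟩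
    · ext x
      simp only [mem_inter, mem_insert, mem_singleton]
      constructor
      · rintro ⟨h1, h2 | h2⟩
        · exact h2
        · exact absurd h1 (hdis x h2)
      · rintro rfl; exact ⟨he, Or.inl rfl⟩
    · rw [card_insert_of_notMem (fun hx => hdis e hx he)]; omega
  by_cases hex : ∃ e ∈ E \ X, e ≠ ep
  · obtain ⟨e, he, hep⟩ := hex
    rw [mem_sdiff] at he
    refine ⟨e, insert e R, hep, (key e he.1).1, (key e he.1).2, ?_⟩
    rcases hR with hR | hR
    · left
      have : insert e R \ Xᶜ = ∅ := by
        ext x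
        simp only [mem_sdiff, mem_insert, mem_compl, notMem_empty, iff_false, not_and, not_not]
        rintro (rfl | hx)
        · exact he.2
        · simpa using hR hx
      rw [this]; simp
    · have h1 : Xᶜ \ insert e R ⊆ (E \ X).erase e := by
        intro x hx
        simp only [mem_sdiff, mem_insert, mem_compl, not_or, mem_erase] at hx ⊢
        refine ⟨hx.2.1, ?_, hx.1⟩
        by_contra hxE
        exact hx.2.2 (hR (by simp [hxE, hx.1]))
      have h1' := card_le_card h1
      have h1'' := card_erase_of_mem (mem_sdiff.2 he)
      have h2 : insert e R \ Xᶜ ⊆ R \ (Eᶜ ∩ Xᶜ) := by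
        intro x hx
        simp only [mem_sdiff, mem_insert, mem_compl, not_not, mem_inter, not_and] at hx ⊢
        rcases hx with ⟨rfl | hx, hxX⟩
        · exact absurd hxX he.2
        · exact ⟨hx, fun _ => hxX⟩
      have h2' := card_le_card h2
      have h2'' := card_sdiff_add_card_eq_card hR
      have h3 : #(Eᶜ ∩ Xᶜ) + #(X \ E) = #Eᶜ := by
        have := card_inter_add_card_sdiff Eᶜ Xᶜ
        have h4 : Eᶜ \ Xᶜ = X \ E := by ext x; simp [and_comm]
        rwa [h4] at this
      have h5 : 0 < #(E \ X) := card_pos.2 ⟨e, mem_sdiff.2 he⟩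
      rcases hX with hX | hX
      · right; omega
      · left; omega
  -- The only wrong color of `E` is at most `ep`, which may not be reused. At most one error then
  -- survives, within the bound `k + 1`.
  · push Not at hex
    have hsub : E \ X ⊆ {ep} := fun x hx => by simpa using hex x hx
    obtain ⟨e, he, hep⟩ := exists_mem_ne (by omega : 1 < #E) ep
    refine ⟨e, insert e R, hep, (key e he).1, (key e he).2, ?_⟩
    rcases hR with hR | hR
    · left
      have : insert e R \ Xᶜ ⊆ {e} := by
        intro x hx
        simp only [mem_sdiff, mem_insert, mem_compl, not_not, mem_singleton] at hx ⊢
        rcases hx with ⟨rfl | hx, hxX⟩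
        · rfl
        · exact absurd hxX (by simpa using hR hx)
      have := card_le_card this
      rw [card_singleton] at this; omega
    · right
      have : Xᶜ \ insert e R ⊆ {ep} := by
        intro x hx
        apply hsub
        simp only [mem_sdiff, mem_insert, mem_compl, not_or] at hx ⊢
        refine ⟨?_, hx.1⟩
        by_contra hxE
        exact hx.2.2 (hR (by simp [hxE, hx.1]))
      have := card_le_card this
      rw [card_singleton] at this; omega

/-- The last two palettes are built backwards. `E2` consists of `t`, `y` and colors outside `F`,
taken from `E` where possible so that `E ∪ E2` stays small; `E1` then needs `d1 - 2` colors outside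
that union besides `e` and `y`. -/
theorem exists_palette_landing (E F : Finset C) (e t y : C) (d1 d2 : ℕ)
    (he : e ∈ E) (het : e ≠ t) (ht : t ∈ F) (hyF : y ∉ F) (hyE : y ∉ E)
    (hd1 : 2 ≤ d1) (hd2 : 2 ≤ d2) (h1 : #E + d1 ≤ Fintype.card C) (h2 : d1 + d2 ≤ Fintype.card C)
    (h3 : d2 + #F ≤ Fintype.card C)
    (hE : #E ≤ 2 ∨ #(E ∩ F) ≤ 1 ∨ #(Fᶜ \ E) ≤ 1) :
    ∃ E1 E2 : Finset C, E ∩ E1 = {e} ∧ E1 ∩ E2 = {y} ∧ E2 ∩ F = {t} ∧ #E1 = d1 ∧ #E2 = d2 := by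
  have hey : e ≠ y := fun h => hyE (h ▸ he)
  have hty : t ≠ y := fun h => hyF (h ▸ ht)
  have hFc : d2 ≤ #Fᶜ := by rw [card_compl]; omega
  have hFc1 : #Fᶜ ≤ #((Fᶜ.erase e).erase y) + 2 := by
    have := pred_card_le_card_erase (s := Fᶜ) (a := e)
    have := pred_card_le_card_erase (s := Fᶜ.erase e) (a := y)
    omega
  obtain ⟨R, hRU, hRc, hR⟩ := exists_subset_card_eq_preferring ((Fᶜ.erase e).erase y) E
    (m := d2 - 2) (by omega)
  have hRm : ∀ x ∈ R, x ≠ y ∧ x ≠ e ∧ x ∉ F := fun x hx => by simpa using hRU hx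
  set E2 := insert t (insert y R) with hE2
  have hyR : y ∉ R := fun h => (hRm y h).1 rfl
  have htR : t ∉ insert y R := by
    simp only [mem_insert, not_or]; exact ⟨hty, fun h => (hRm t h).2.2 ht⟩
  have hE2c : #E2 = d2 := by
    rw [hE2, card_insert_of_notMem htR, card_insert_of_notMem hyR]; omega
  -- It suffices that one of `E2 \ E`, `E \ E2` has at most two elements: the union then exceeds
  -- `#E` or `d2` by at most two, and each of these sums with `d1` to at most the number of colors.
  have hunion : #(E ∪ E2) + d1 ≤ Fintype.card C + 2 := by
    have hcase : #(E2 \ E) ≤ 2 ∨ #(E \ E2) ≤ 2 := by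
      rcases hR with hR | hR
      · left
        have : E2 \ E ⊆ {t, y} := by
          intro x hx
          simp only [hE2, mem_sdiff, mem_insert, mem_singleton] at hx ⊢
          rcases hx with ⟨rfl | rfl | hx, hxE⟩
          · simp
          · simp
          · exact absurd (hR hx) hxE
        exact (card_le_card this).trans card_le_two
      · rcases hE with hE | hE | hE
        · right; exact (card_le_card sdiff_subset).trans hE
        · right
          have : E \ E2 ⊆ insert e (E ∩ F) := by
            intro x hx
            simp only [hE2, mem_sdiff, mem_insert, not_or, mem_inter] at hx ⊢
            by_cases hxe : x = e
            · exact Or.inl hxe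
            · right
              refine ⟨hx.1, ?_⟩
              by_contra hxF
              exact hx.2.2.2 (hR (by simp [hxe, hxF, hx.1, hx.2.2.1]))
          have := card_le_card this
          have := card_insert_le e (E ∩ F)
          omega
        · left
          have hsd : (Fᶜ.erase e).erase y \ ((Fᶜ.erase e).erase y ∩ E) ⊆ (Fᶜ \ E).erase y := by
            intro x hx
            simp only [mem_sdiff, mem_erase, mem_compl, mem_inter, not_and] at hx ⊢
            exact ⟨hx.1.1, hx.1.2.2, hx.2 hx.1⟩
          have hemp : (Fᶜ \ E).erase y = ∅ := by
            rw [← card_eq_zero, card_erase_of_mem (by simp [hyF, hyE])]; omega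
          have hRE : R ⊆ E := by
            intro x hx
            by_contra hxE
            have : x ∈ (Fᶜ \ E).erase y := by
              have := hRm x hx
              simp [this.1, this.2.2, hxE]
            rw [hemp] at this; simp at this
          have : E2 \ E ⊆ {t, y} := by
            intro x hx
            simp only [hE2, mem_sdiff, mem_insert, mem_singleton] at hx ⊢
            rcases hx with ⟨rfl | rfl | hx, hxE⟩
            · simp
            · simp
            · exact absurd (hRE hx) hxE
          exact (card_le_card this).trans card_le_two
    have hu1 := card_union_add_card_inter E E2
    have hu2 := card_inter_add_card_sdiff E E2
    have hu3 := card_inter_add_card_sdiff E2 E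
    rw [inter_comm E2 E] at hu3
    omega
  obtain ⟨W, hWU, hWc⟩ := exists_subset_card_eq (s := (E ∪ E2)ᶜ) (n := d1 - 2)
    (by rw [card_compl]; omega)
  have hWm : ∀ x ∈ W, x ∉ E ∧ x ∉ E2 := fun x hx => by
    have := hWU hx
    simp only [mem_compl, mem_union, not_or] at this
    exact this
  have hyE2 : y ∈ E2 := by simp [hE2]
  have heE2 : e ∉ E2 := by
    simp only [hE2, mem_insert, not_or]; exact ⟨het, hey, fun h => (hRm e h).2.1 rfl⟩
  have hyW : y ∉ W := fun h => (hWm y h).2 hyE2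
  have heW : e ∉ insert y W := by
    simp only [mem_insert, not_or]; exact ⟨hey, fun h => (hWm e h).1 he⟩
  refine ⟨insert e (insert y W), E2, ?_, ?_, ?_, ?_, hE2c⟩
  · ext x
    simp only [mem_inter, mem_insert, mem_singleton]
    constructor
    · rintro ⟨hx, rfl | rfl | hxW⟩
      · rfl
      · exact absurd hx hyE
      · exact absurd hx (hWm x hxW).1
    · rintro rfl; exact ⟨he, Or.inl rfl⟩
  · ext x
    simp only [mem_inter, mem_insert, mem_singleton]
    constructor
    · rintro ⟨rfl | rfl | hxW, hx⟩
      · exact absurd hx heE2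
      · rfl
      · exact absurd hx (hWm x hxW).2
    · rintro rfl; exact ⟨Or.inr (Or.inl rfl), hyE2⟩
  · ext x
    simp only [hE2, mem_inter, mem_insert, mem_singleton]
    constructor
    · rintro ⟨rfl | rfl | hxR, hx⟩
      · rfl
      · exact absurd hx hyF
      · exact absurd hx (hRm x hxR).2.2
    · rintro rfl; exact ⟨Or.inl rfl, ht⟩
  · rw [card_insert_of_notMem heW, card_insert_of_notMem hyW]; omega

theorem inter_insert_eq_singleton {Z R : Finset C} {e : C} (he : e ∈ Z) (hR : R ⊆ Zᶜ) :
    Z ∩ insert e R = {e} := by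
  ext x
  simp only [mem_inter, mem_insert, mem_singleton]
  constructor
  · rintro ⟨h1, h2 | h2⟩
    · exact h2
    · exact absurd h1 (by simpa using hR h2)
  · rintro rfl; exact ⟨he, Or.inl rfl⟩

theorem card_insert_of_subset_compl {Z R : Finset C} {e : C} (he : e ∈ Z) (hR : R ⊆ Zᶜ) :
    #(insert e R) = #R + 1 :=
  card_insert_of_notMem fun h => by simpa [he] using hR h

/-- Prepares the landing: besides being nearly complementary to `F`, the palette must offer an
outgoing color `x` different from `e` and `t`, and must leave some `y` outside both itself and `F`
for the edge after that. -/
theorem exists_palette_approach (Z F : Finset C) (ep t : C) (d : ℕ) (hC : 5 ≤ Fintype.card C)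
    (hZ : 2 ≤ #Z) (hd : 2 ≤ d) (h : #Z + d ≤ Fintype.card C) (hF : #F + 2 ≤ Fintype.card C)
    (hZF : #(Z \ F) ≤ 1 ∨ #(F \ Z) ≤ 1) :
    ∃ (e : C) (E : Finset C), e ≠ ep ∧ Z ∩ E = {e} ∧ #E = d ∧ (∃ x ∈ E, x ≠ e ∧ x ≠ t) ∧
      (∃ y, y ∉ F ∧ y ∉ E) ∧ (#E ≤ 2 ∨ #(E ∩ F) ≤ 1 ∨ #(Fᶜ \ E) ≤ 1) := by
  have hZc : d ≤ #Zᶜ := by rw [card_compl]; omega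
  have hZZ : #Z + #Zᶜ = Fintype.card C := card_add_card_compl Z
  have hFc : 2 ≤ #Fᶜ := by rw [card_compl]; omega
  rcases hd.eq_or_lt with rfl | hd3
  · -- a vertex of degree two
    have hxe : ∃ e ∈ Z, e ≠ ep ∧ ∃ x ∈ Zᶜ, x ≠ t ∧ Fᶜ ≠ {e, x} := by
      by_cases hZ3 : 3 ≤ #Z
      · obtain ⟨x, hx, hxt⟩ := exists_mem_ne (by omega : 1 < #Zᶜ) t
        have : 1 < #(Z.erase ep) := by
          have := pred_card_le_card_erase (s := Z) (a := ep); omega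
        obtain ⟨e1, h1, e2, h2, h12⟩ := one_lt_card.1 this
        rw [mem_erase] at h1 h2
        by_cases hf : Fᶜ = {e1, x}
        · refine ⟨e2, h2.2, h2.1, x, hx, hxt, fun hf2 => ?_⟩
          have : e1 ∈ ({e2, x} : Finset C) := by rw [← hf2, hf]; simp
          simp only [mem_insert, mem_singleton] at this
          rcases this with h | h
          · exact h12 h
          · rw [mem_compl] at hx; exact hx (h ▸ h1.2)
        · exact ⟨e1, h1.2, h1.1, x, hx, hxt, hf⟩
      · obtain ⟨e, he, hep⟩ := exists_mem_ne (by omega : 1 < #Z) ep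
        have : 1 < #(Zᶜ.erase t) := by
          have := pred_card_le_card_erase (s := Zᶜ) (a := t); omega
        obtain ⟨x1, h1, x2, h2, h12⟩ := one_lt_card.1 this
        rw [mem_erase] at h1 h2
        by_cases hf : Fᶜ = {e, x1}
        · refine ⟨e, he, hep, x2, h2.2, h2.1, fun hf2 => ?_⟩
          have : x1 ∈ ({e, x2} : Finset C) := by rw [← hf2, hf]; simp
          simp only [mem_insert, mem_singleton] at this
          rcases this with h | h
          · have := h1.2; rw [mem_compl] at this; exact this (h ▸ he)
          · exact h12 h
        · exact ⟨e, he, hep, x1, h1.2, h1.1, hf⟩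
    obtain ⟨e, he, hep, x, hx, hxt, hf⟩ := hxe
    have hxe : x ≠ e := fun h => by rw [mem_compl] at hx; exact hx (h ▸ he)
    have hc : #({e, x} : Finset C) = 2 := card_pair hxe.symm
    refine ⟨e, {e, x}, hep, inter_insert_eq_singleton he (by simpa using hx), hc,
      ⟨x, by simp, hxe, hxt⟩, ?_, Or.inl hc.le⟩
    by_contra hno
    push Not at hno
    refine hf (eq_of_subset_of_card_le (fun y hy => hno y (by simpa using hy)) (by omega))
  · obtain ⟨e, he, hep⟩ := exists_mem_ne (by omega : 1 < #Z) ep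
    have hfree : ∀ E : Finset C, #E = d → ∃ x ∈ E, x ≠ e ∧ x ≠ t := by
      intro E hE
      have : 0 < #((E.erase e).erase t) := by
        have := pred_card_le_card_erase (s := E) (a := e)
        have := pred_card_le_card_erase (s := E.erase e) (a := t)
        omega
      obtain ⟨x, hx⟩ := card_pos.1 this
      simp only [mem_erase] at hx
      exact ⟨x, hx.2.2, hx.2.1, hx.1⟩
    have hsplit : #(Zᶜ ∩ Fᶜ) + #(F \ Z) = #Zᶜ := by
      have := card_inter_add_card_sdiff Zᶜ Fᶜ
      have h4 : Zᶜ \ Fᶜ = F \ Z := by ext x; simp [and_comm]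
      rwa [h4] at this
    by_cases ha : d ≤ #(Zᶜ ∩ Fᶜ)
    · obtain ⟨R, hR, hRc⟩ := exists_subset_card_eq (s := Zᶜ ∩ Fᶜ) (n := d - 1) (by omega)
      have hRZ := hR.trans inter_subset_left
      have hEc : #(insert e R) = d := by rw [card_insert_of_subset_compl he hRZ]; omega
      refine ⟨e, insert e R, hep, inter_insert_eq_singleton he hRZ, hEc, hfree _ hEc, ?_,
        Or.inr (Or.inl ?_)⟩
      · have : ∃ y ∈ Zᶜ ∩ Fᶜ, y ∉ R := by
          by_contra hno
          push Not at hno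
          have := card_le_card (fun y hy => hno y hy : Zᶜ ∩ Fᶜ ⊆ R)
          omega
        obtain ⟨y, hy, hyR⟩ := this
        simp only [mem_inter, mem_compl] at hy
        refine ⟨y, hy.2, ?_⟩
        simp only [mem_insert, not_or]
        exact ⟨fun h => hy.1 (h ▸ he), hyR⟩
      · have : insert e R ∩ F ⊆ {e} := by
          intro x hx
          simp only [mem_inter, mem_insert, mem_singleton] at hx ⊢
          rcases hx with ⟨rfl | hx, hxF⟩
          · rfl
          · have := hR hx; simp [hxF] at this
        simpa using card_le_card this
    · by_cases hb : ∃ y, y ∉ F ∧ y ∈ Z ∧ y ≠ e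
      · obtain ⟨y, hyF, hyZ, hye⟩ := hb
        obtain ⟨R, hR1, hRZ, hRc⟩ := exists_subsuperset_card_eq
          (inter_subset_left : Zᶜ ∩ Fᶜ ⊆ Zᶜ) (by omega : #(Zᶜ ∩ Fᶜ) ≤ d - 1) (by omega)
        have hEc : #(insert e R) = d := by rw [card_insert_of_subset_compl he hRZ]; omega
        refine ⟨e, insert e R, hep, inter_insert_eq_singleton he hRZ, hEc, hfree _ hEc,
          ⟨y, hyF, ?_⟩, Or.inr ?_⟩
        · simp only [mem_insert, not_or]
          exact ⟨hye, fun h => by simpa [hyZ] using hRZ h⟩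
        · rcases hZF with hZF | hZF
          · right
            refine (card_le_card ?_).trans hZF
            intro x hx
            simp only [mem_sdiff, mem_compl, mem_insert, not_or] at hx ⊢
            refine ⟨?_, hx.1⟩
            by_contra hxZ
            exact hx.2.2 (hR1 (by simp [hxZ, hx.1]))
          · left
            have hRF : R \ (Zᶜ ∩ Fᶜ) = ∅ := by
              rw [← card_eq_zero]
              have := card_sdiff_add_card_eq_card hR1
              omega
            have : insert e R ∩ F ⊆ {e} := by
              intro x hx
              simp only [mem_inter, mem_insert, mem_singleton] at hx ⊢
              rcases hx with ⟨rfl | hx, hxF⟩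
              · rfl
              · have : x ∈ R \ (Zᶜ ∩ Fᶜ) := by simp [hx, hxF]
                rw [hRF] at this; simp at this
            simpa using card_le_card this
      -- Here `Fᶜ` meets `Z` at most in `e`, so no spare `y` is available in `Z`. One color `y` of
      -- `Zᶜ ∩ Fᶜ` is withheld from the new palette instead.
      · push Not at hb
        obtain ⟨y, hy, hye⟩ := exists_mem_ne (by omega : 1 < #Fᶜ) e
        have hyF : y ∉ F := by simpa using hy
        have hyZ : y ∉ Z := fun hyZ => hye (hb y hyF hyZ)
        have hymem : y ∈ Zᶜ ∩ Fᶜ := by simp [hyF, hyZ]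
        have hpos : 0 < #(Zᶜ ∩ Fᶜ) := card_pos.2 ⟨y, hymem⟩
        have hsub : (Zᶜ ∩ Fᶜ).erase y ⊆ Zᶜ.erase y := erase_subset_erase _ inter_subset_left
        have hc1 : #((Zᶜ ∩ Fᶜ).erase y) = #(Zᶜ ∩ Fᶜ) - 1 := card_erase_of_mem hymem
        have hc2 : #(Zᶜ.erase y) = #Zᶜ - 1 := card_erase_of_mem (by simpa using hyZ)
        obtain ⟨R, hR1, hRZ', hRc⟩ := exists_subsuperset_card_eq hsub
          (by omega : #((Zᶜ ∩ Fᶜ).erase y) ≤ d - 1) (by omega)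
        have hRZ := hRZ'.trans (erase_subset _ _)
        have hEc : #(insert e R) = d := by rw [card_insert_of_subset_compl he hRZ]; omega
        refine ⟨e, insert e R, hep, inter_insert_eq_singleton he hRZ, hEc, hfree _ hEc,
          ⟨y, hyF, ?_⟩, Or.inr (Or.inr ?_)⟩
        · simp only [mem_insert, not_or]
          exact ⟨hye, fun h => by simpa using hRZ' h⟩
        · have : Fᶜ \ insert e R ⊆ {y} := by
            intro x hx
            simp only [mem_sdiff, mem_compl, mem_insert, not_or, mem_singleton] at hx ⊢
            by_contra hxy
            by_cases hxZ : x ∈ Z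
            · exact hx.2.1 (hb x hx.1 hxZ)
            · exact hx.2.2 (hR1 (by simp [hxZ, hx.1, hxy]))
          simpa using card_le_card this

end ThreadSteps

/-! ### Palettes along a whole thread -/

section Threads

open Finset

variable {C : Type*} [Fintype C] [DecidableEq C]

/-- The `k`-th iterated complement of `F`. -/
def iterCompl (F : Finset C) : ℕ → Finset C
  | 0 => F
  | k + 1 => (iterCompl F k)ᶜ

/-- `k` correcting steps reduce the error from `k + 1` to one; an approach and a landing cover the
remaining three inner palettes. The target alternates between `F` and its complement, according to
the parity of the distance to the end. -/
theorem exists_palettes_of_close (F : Finset C) (t : C) (ht : t ∈ F) (hC : 5 ≤ Fintype.card C) :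
    ∀ (k : ℕ) (d : ℕ → ℕ) (E₀ : Finset C) (ep : C), (∀ i ≤ k + 4, 2 ≤ d i) →
      (∀ i < k + 4, d i + d (i + 1) ≤ Fintype.card C) → #E₀ = d 0 → #F = d (k + 4) →
      (#(E₀ \ iterCompl F k) ≤ k + 1 ∨ #(iterCompl F k \ E₀) ≤ k + 1) →
      ∃ (E : ℕ → Finset C) (e : ℕ → C), E 0 = E₀ ∧ E (k + 4) = F ∧ e 0 ≠ ep ∧ e (k + 3) = t ∧
        (∀ i < k + 4, E i ∩ E (i + 1) = {e i}) ∧ (∀ i < k + 3, e i ≠ e (i + 1)) ∧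
        ∀ i ≤ k + 4, #(E i) = d i := by
  intro k
  induction k with
  | zero =>
    intro d Z ep hd2 hds hZ hF hclose
    have hs0 := hds 0 (by omega)
    have hs1 := hds 1 (by omega)
    have hs2 := hds 2 (by omega)
    have hs3 := hds 3 (by omega)
    have h0 := hd2 0 (by omega)
    have h1 := hd2 1 (by omega)
    have h2 := hd2 2 (by omega)
    have h3 := hd2 3 (by omega)
    simp only [zero_add, Nat.reduceAdd] at *
    obtain ⟨e0, E1, he0, hZE1, hE1, ⟨e1, he1, he10, he1t⟩, ⟨y, hyF, hyE⟩, hcl⟩ :=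
      exists_palette_approach Z F ep t (d 1) hC (by omega) h1 (by omega) (by omega) hclose
    obtain ⟨E2, E3, h12, h23, h34, hE2, hE3⟩ := exists_palette_landing E1 F e1 t y (d 2) (d 3)
      he1 he1t ht hyF hyE h2 h3 (by omega) hs2 (by omega) hcl
    refine ⟨fun i => match i with | 0 => Z | 1 => E1 | 2 => E2 | 3 => E3 | _ => F,
      fun i => match i with | 0 => e0 | 1 => e1 | 2 => y | _ => t, rfl, rfl, he0, rfl, ?_, ?_, ?_⟩
    · intro i hi
      interval_cases i <;> assumption
    · intro i hi
      have hey : e1 ≠ y := fun h => hyE (h ▸ he1)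
      have hyt : y ≠ t := fun h => hyF (h ▸ ht)
      interval_cases i
      · exact he10.symm
      · exact hey
      · exact hyt
    · intro i hi
      interval_cases i <;> assumption
  | succ k ih =>
    intro d E₀ ep hd2 hds hE₀ hF hclose
    have hs0 := hds 0 (by omega)
    obtain ⟨e, E1, hep, hE01, hE1, hcl⟩ := exists_palette_step E₀ (iterCompl F (k + 1)) ep (d 1) k
      (by have := hd2 0 (by omega); omega) (hd2 1 (by omega)) (by simp only [zero_add] at hs0; omega)
      hclose
    simp only [iterCompl, compl_compl] at hcl
    obtain ⟨E, g, hE0, hEk, hg0, hgt, hint, hne, hcard⟩ := ih (fun i => d (i + 1)) E1 e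
      (fun i hi => hd2 _ (by omega)) (fun i hi => hds _ (by omega)) hE1
      hF hcl
    refine ⟨fun i => i.casesOn E₀ E, fun i => i.casesOn e g, rfl, ?_, hep, ?_, ?_, ?_, ?_⟩
    · rw [show k + 1 + 4 = (k + 4) + 1 by omega]; exact hEk
    · rw [show k + 1 + 3 = (k + 3) + 1 by omega]; exact hgt
    · rintro (_ | i) hi
      · simpa [hE0] using hE01
      · exact hint i (by omega)
    · rintro (_ | i) hi
      · exact hg0.symm
      · exact hne i (by omega)
    · rintro (_ | i) hi
      · exact hE₀
      · exact hcard i (by omega)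

/-- Palettes of the two ends of a long enough thread, with prescribed end colors, extend to the
whole thread. -/
theorem exists_palettes_thread (l : ℕ) (hC : 5 ≤ Fintype.card C) (hl : Fintype.card C / 2 + 3 ≤ l)
    (d : ℕ → ℕ) (hd2 : ∀ i ≤ l + 1, 2 ≤ d i) (hds : ∀ i ≤ l, d i + d (i + 1) ≤ Fintype.card C)
    (E₀ F : Finset C) (a t : C) (ha : a ∈ E₀) (ht : t ∈ F) (hE₀ : #E₀ = d 0)
    (hF : #F = d (l + 1)) :
    ∃ (E : ℕ → Finset C) (e : ℕ → C), E 0 = E₀ ∧ E (l + 1) = F ∧ e 0 = a ∧ e l = t ∧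
      (∀ i ≤ l, E i ∩ E (i + 1) = {e i}) ∧ (∀ i < l, e i ≠ e (i + 1)) ∧
      ∀ i ≤ l + 1, #(E i) = d i := by
  obtain ⟨k, rfl⟩ : ∃ k, l = k + 4 := ⟨l - 4, by omega⟩
  have hs0 := hds 0 (by omega)
  have h1 := hd2 1 (by omega)
  simp only [zero_add] at hs0
  obtain ⟨R, hR, hRc⟩ := exists_subset_card_eq (s := E₀ᶜ) (n := d 1 - 1)
    (by rw [card_compl]; omega)
  set E1 := insert a R with hE1
  have hE1c : #E1 = d 1 := by rw [hE1, card_insert_of_subset_compl ha hR]; omega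
  -- The two differences are disjoint, so one of them has at most half of all colors. This is where
  -- the length `Fintype.card C / 2 + 3` comes from.
  have hclose : #(E1 \ iterCompl F k) ≤ k + 1 ∨ #(iterCompl F k \ E1) ≤ k + 1 := by
    have hdis : Disjoint (E1 \ iterCompl F k) (iterCompl F k \ E1) :=
      disjoint_sdiff_sdiff
    have := card_le_univ (E1 \ iterCompl F k ∪ iterCompl F k \ E1)
    rw [card_union_of_disjoint hdis] at this
    omega
  obtain ⟨E, g, hE0, hEk, hg0, hgt, hint, hne, hcard⟩ := exists_palettes_of_close F t ht hC k
    (fun i => d (i + 1)) E1 a (fun i hi => hd2 _ (by omega)) (fun i hi => hds _ (by omega)) hE1c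
    hF hclose
  refine ⟨fun i => i.casesOn E₀ E, fun i => i.casesOn a g, rfl, hEk, rfl, hgt, ?_, ?_, ?_⟩
  · rintro (_ | i) hi
    · simpa [hE0] using inter_insert_eq_singleton ha hR
    · exact hint i (by omega)
  · rintro (_ | i) hi
    · exact hg0.symm
    · exact hne i (by omega)
  · rintro (_ | i) hi
    · exact hE₀
    · exact hcard i (by omega)

end Threads

/-! ### Palettes around a cycle -/

/-- The successor of `i` on the cycle with vertices `0, …, n - 1`. -/
def cycSucc (n i : ℕ) : ℕ := if i + 1 = n then 0 else i + 1

/-- The predecessor of `i` on the cycle with vertices `0, …, n - 1`. -/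
def cycPred (n i : ℕ) : ℕ := if i = 0 then n - 1 else i - 1

open Finset in
/-- Vertices of a cycle of length `n` can be given palettes of at least the prescribed sizes from
`s` colors such that adjacent palettes share exactly the color of their edge. -/
def CyclePalettes (n s : ℕ) (d : ℕ → ℕ) : Prop :=
  ∃ (E : ℕ → Finset ℕ) (e : ℕ → ℕ), ∀ i < n, E i ⊆ range s ∧ d i ≤ #(E i) ∧ e i ∈ E i ∧
    e i ∈ E (cycSucc n i) ∧ (∀ c ∈ E i, c ∈ E (cycSucc n i) → c = e i) ∧ e i ≠ e (cycSucc n i)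

section Cycles

open Finset

theorem cycSucc_lt {n i : ℕ} (hi : i < n) : cycSucc n i < n := by
  unfold cycSucc; split_ifs <;> omega

theorem cycPred_cycSucc {n i : ℕ} (_hi : i < n) : cycPred n (cycSucc n i) = i := by
  unfold cycSucc cycPred
  by_cases h : i + 1 = n
  · rw [if_pos h, if_pos rfl]; omega
  · rw [if_neg h, if_neg (by omega)]; omega

/-- The cycle edges use colors below 4. Leaf colors are taken from the bottom or the top of the
other `s - 4`, by class; neighbors of different classes need at most `s - 4` in total, so their
reserves are disjoint. A vertex of degree two needs no reserve. -/
theorem cyclePalettes_of_four_colors (n s : ℕ) (d e : ℕ → ℕ) (cl : ℕ → Prop) (hn : 1 < n)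
    (hs : 4 ≤ s)
    (hd : ∀ i < n, 2 ≤ d i) (hds : ∀ i < n, d i + d (cycSucc n i) ≤ s) (he4 : ∀ i < n, e i < 4)
    (he : ∀ i < n, e (cycPred n i) ≠ e i ∧ e (cycPred n i) ≠ e (cycSucc n i))
    (hcl : ∀ i < n, ¬ (cl i ↔ cl (cycSucc n i)) ∨ d i = 2 ∨ d (cycSucc n i) = 2) :
    CyclePalettes n s d := by
  classical
  let L : ℕ → Finset ℕ := fun i => if cl i then Ico 4 (4 + (d i - 2)) else Ico (s - (d i - 2)) s
  have hLm : ∀ i c, c ∈ L i → (cl i ∧ 4 ≤ c ∧ c < 4 + (d i - 2)) ∨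
      (¬ cl i ∧ s - (d i - 2) ≤ c ∧ c < s) := by
    intro i c hc
    by_cases h : cl i
    · left; simpa [L, h] using hc
    · right; simpa [L, h] using hc
  have hLle : ∀ i < n, ∀ c ∈ L i, 4 ≤ c ∧ c < s := by
    intro i hi c hc
    have h1 := hds i hi
    have h2 := hd _ (cycSucc_lt hi)
    rcases hLm i c hc with h | h <;> omega
  have hpred : ∀ i < n, cycPred n i < n := by
    intro i hi; unfold cycPred; split_ifs <;> omega
  refine ⟨fun i => insert (e (cycPred n i)) (insert (e i) (L i)), e, fun i hi => ?_⟩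
  have hi' := cycSucc_lt hi
  have hds1 := hds i hi
  have hdi := hd i hi
  have hdi' := hd _ hi'
  simp only [cycPred_cycSucc hi]
  refine ⟨?_, ?_, by simp, by simp, ?_, ?_⟩
  · intro c hc
    simp only [mem_insert] at hc
    rw [mem_range]
    rcases hc with rfl | rfl | hc
    · have := he4 _ (hpred i hi); omega
    · have := he4 _ hi; omega
    · exact (hLle i hi c hc).2
  · have hc : #(L i) = d i - 2 := by
      by_cases h : cl i
      · simp [L, h]
      · simp only [L, h, if_false, Nat.card_Ico]; omega
    rw [card_insert_of_notMem, card_insert_of_notMem, hc]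
    · omega
    · intro h; have := hLle i hi _ h; have := he4 i hi; omega
    · simp only [mem_insert, not_or]
      refine ⟨(he i hi).1, fun h => ?_⟩
      have := hLle i hi _ h; have := he4 _ (hpred i hi); omega
  · intro c hc hc'
    simp only [mem_insert] at hc hc'
    have e1 := he4 _ (hpred i hi)
    have e2 := he4 _ hi
    have e3 := he4 _ hi'
    have n1 := (he i hi).2
    rcases hc with rfl | rfl | hc
    · rcases hc' with h | h | h
      · exact h
      · exact absurd h n1
      · have := hLle _ hi' _ h; omega
    · rfl
    · rcases hc' with rfl | rfl | hc'
      · rfl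
      · have := hLle i hi _ hc; omega
      · exfalso
        have h1 := hLm i c hc
        have h2 := hLm _ c hc'
        rcases hcl i hi with h | h | h
        · rcases h1 with h1 | h1 <;> rcases h2 with h2 | h2
          · exact h (iff_of_true h1.1 h2.1)
          · omega
          · omega
          · exact h (iff_of_false h1.1 h2.1)
        · omega
        · omega
  · have := (he _ hi').1
    rwa [cycPred_cycSucc hi] at this

theorem exists_four_coloring_cycle (n : ℕ) (hn : 3 ≤ n) (hn5 : n ≠ 5) :
    ∃ e : ℕ → ℕ, (∀ i < n, e i < 4) ∧
      ∀ i < n, e (cycPred n i) ≠ e i ∧ e (cycPred n i) ≠ e (cycSucc n i) := by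
  -- Blocks 0123, `n % 3` of them, followed by blocks 012; this fits for every `n ≥ 3` except 5.
  refine ⟨fun i => if i < 4 * (n % 3) then i % 4 else (i - 4 * (n % 3)) % 3, ?_, ?_⟩
  · intro i hi
    dsimp only
    split_ifs <;> omega
  · intro i hi
    have h3 : n % 3 = 0 ∨ n % 3 = 1 ∨ n % 3 = 2 := by omega
    unfold cycPred cycSucc
    dsimp only
    rcases h3 with h | h | h <;> rw [h] <;> constructor <;> split_ifs <;> omega

theorem cyclePalettes_of_even (n s : ℕ) (d : ℕ → ℕ) (hn : 3 ≤ n) (he : Even n) (hs : 4 ≤ s)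
    (hd : ∀ i < n, 2 ≤ d i) (hds : ∀ i < n, d i + d (cycSucc n i) ≤ s) : CyclePalettes n s d := by
  rw [Nat.even_iff] at he
  obtain ⟨e, he4, hee⟩ := exists_four_coloring_cycle n hn (by omega)
  refine cyclePalettes_of_four_colors n s d e (fun i => i % 2 = 0) (by omega) hs hd hds he4 hee
    fun i hi => Or.inl ?_
  unfold cycSucc
  split_ifs <;> omega

/-- Two classes can alternate on an odd cycle except at one place, and that place is put at `v`,
whose reserve is empty. The 5-cycle needs five edge colors and is treated apart. -/
theorem cyclePalettes_of_degree_two (n s : ℕ) (d : ℕ → ℕ) (hn : 3 ≤ n) (ho : Odd n) (hs : 5 ≤ s)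
    (hd : ∀ i < n, 2 ≤ d i) (hds : ∀ i < n, d i + d (cycSucc n i) ≤ s) (v : ℕ) (hv : v < n)
    (hdv : d v = 2) : CyclePalettes n s d := by
  rw [Nat.odd_iff] at ho
  have hclass : ∀ i < n, i ≠ v → cycSucc n i ≠ v →
      ¬ ((if i < v then (i + v) % 2 = 0 else (i + v) % 2 = 1) ↔
        (if cycSucc n i < v then (cycSucc n i + v) % 2 = 0 else (cycSucc n i + v) % 2 = 1)) := by
    intro i hi h1 h2
    unfold cycSucc at *
    split_ifs at * <;> omega
  by_cases hn5 : n = 5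
  · classical
    let cl : ℕ → Prop := fun i => if i < v then (i + v) % 2 = 0 else (i + v) % 2 = 1
    let L : ℕ → Finset ℕ := fun i =>
      if cl i then Ico 5 (5 + (d i - 3)) else Ico (s - (d i - 3)) s
    have hLm : ∀ i c, c ∈ L i → (cl i ∧ 5 ≤ c ∧ c < 5 + (d i - 3)) ∨
        (¬ cl i ∧ s - (d i - 3) ≤ c ∧ c < s) := by
      intro i c hc
      by_cases h : cl i
      · left; simpa [L, h] using hc
      · right; simpa [L, h] using hc
    have hLle : ∀ i < n, ∀ c ∈ L i, 5 ≤ c ∧ c < s := by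
      intro i hi c hc
      have h1 := hds i hi
      have h2 := hd _ (cycSucc_lt hi)
      rcases hLm i c hc with h | h <;> omega
    -- Each vertex also receives the color `i + 2` of a non-incident edge, so only `d i - 3` reserve
    -- colors are needed out of `s - 5`.
    refine ⟨fun i => {(i + 4) % 5, i, (i + 2) % 5} ∪ L i, id, fun i hi => ?_⟩
    have hi' := cycSucc_lt hi
    have hds1 := hds i hi
    have hdi := hd i hi
    have hdi' := hd _ hi'
    have hsu : cycSucc n i = (i + 1) % 5 := by unfold cycSucc; split_ifs <;> omega
    have hle1 := hLle i hi
    have hle2 := hLle _ hi'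
    refine ⟨?_, ?_, by simp, ?_, ?_, ?_⟩
    · intro c hc
      simp only [mem_union, mem_insert, mem_singleton] at hc
      rw [mem_range]
      rcases hc with (rfl | rfl | rfl) | hc
      · omega
      · omega
      · omega
      · exact (hle1 c hc).2
    · have hc : #(L i) = d i - 3 := by
        by_cases h : cl i
        · simp [L, h]
        · simp only [L, h, if_false, Nat.card_Ico]; omega
      rw [card_union_of_disjoint, hc, card_insert_of_notMem, card_pair]
      · omega
      · omega
      · simp only [mem_insert, mem_singleton]; omega
      · rw [disjoint_left]
        intro c h1 h2
        have := hle1 c h2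
        simp only [mem_insert, mem_singleton] at h1
        omega
    · simp only [mem_union, mem_insert, mem_singleton, id]
      left; left; omega
    · intro c h1 h2
      simp only [mem_union, mem_insert, mem_singleton, id] at h1 h2 ⊢
      rcases h1 with h1 | h1 <;> rcases h2 with h2 | h2
      · omega
      · have := hle2 c h2; omega
      · have := hle1 c h1; omega
      · exfalso
        have m1 := hLm i c h1
        have m2 := hLm _ c h2
        by_cases hiv : i = v
        · subst hiv; omega
        by_cases hiv' : cycSucc n i = v
        · rw [hiv', hdv] at m2; omega
        have := hclass i hi hiv hiv'
        rcases m1 with m1 | m1 <;> rcases m2 with m2 | m2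
        · exact this (iff_of_true m1.1 m2.1)
        · omega
        · omega
        · exact this (iff_of_false m1.1 m2.1)
    · simp only [id]; omega
  · obtain ⟨e, he4, hee⟩ := exists_four_coloring_cycle n hn hn5
    refine cyclePalettes_of_four_colors n s d e
      (fun i => if i < v then (i + v) % 2 = 0 else (i + v) % 2 = 1) (by omega) (by omega)
      hd hds he4 hee fun i hi => ?_
    by_cases hiv : i = v
    · right; left; rw [hiv, hdv]
    by_cases hiv' : cycSucc n i = v
    · right; right; rw [hiv', hdv]
    exact Or.inl (hclass i hi hiv hiv')

/-- Each of the `n` edges has its own color, placed on alternate vertices so that the parity defect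
of the odd cycle puts it on both ends of that edge. Each of the other `2 * m - n` colors is placed
on an independent set; the positions of the defects are consecutive, which balances the palette
sizes. -/
theorem cyclePalettes_of_uniform_short (n m : ℕ) (hn : 3 ≤ n) (ho : Odd n) (h1 : n ≤ 2 * m)
    (h2 : m ≤ n) : CyclePalettes n (2 * m) (fun _ => m) := by
  classical
  rw [Nat.odd_iff] at ho
  let single : ℕ → Finset ℕ := fun v => (range n).filter
    fun i => i = v ∨ (i < v ∧ (i + v) % 2 = 1) ∨ (v < i ∧ (i + v) % 2 = 0)
  let pure : ℕ → Finset ℕ := fun v => (Ico n (2 * m)).filter fun c =>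
    ((c + n - 2 * m < v ∧ (c + n - 2 * m + v) % 2 = 0) ∨
      (v < c + n - 2 * m ∧ (c + n - 2 * m + v) % 2 = 1))
  refine ⟨fun v => single v ∪ pure v, id, fun v hv => ?_⟩
  have hv' := cycSucc_lt hv
  have hsu : cycSucc n v = v + 1 ∧ v + 1 < n ∨ cycSucc n v = 0 ∧ v + 1 = n := by
    unfold cycSucc; split_ifs <;> omega
  generalize cycSucc n v = w at *
  refine ⟨?_, ?_, ?_, ?_, ?_, ?_⟩
  · intro c hc
    simp only [single, pure, mem_union, mem_filter, mem_range, mem_Ico] at hc ⊢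
    omega
  · have hdis : Disjoint (single v) (pure v) := by
      rw [disjoint_left]
      intro c h3 h4
      simp only [single, pure, mem_filter, mem_range, mem_Ico] at h3 h4
      omega
    rw [card_union_of_disjoint hdis]
    -- The image lists the color of edge `v` and every second edge color on either side of it.
    have hs : (n + 1) / 2 ≤ #(single v) := by
      have : #((range ((n + 1) / 2)).image
          fun k => if 2 * k < v then 2 * k + (v + 1) % 2
            else if 2 * k = v ∨ 2 * k = v + 1 then v else 2 * k - v % 2) = (n + 1) / 2 := by
        rw [card_image_of_injOn, card_range]
        intro a ha b hb hab
        simp only [coe_range, Set.mem_Iio] at ha hb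
        dsimp only at hab
        split_ifs at hab <;> omega
      rw [← this]
      apply card_le_card
      intro c hc
      simp only [single, mem_image, mem_range, mem_filter] at hc ⊢
      obtain ⟨k, hk, rfl⟩ := hc
      split_ifs <;> omega
    -- The defect positions are the `2 * m - n` consecutive numbers from `2 * (n - m)` to `n - 1`;
    -- they are grouped in pairs, and each pair contributes a color at `v`.
    have hp : m - (n + 1) / 2 ≤ #(pure v) := by
      have : #((range (m - (n + 1) / 2)).image
          fun k => n + 2 * k + v % 2 + if 2 * (n - m) + 2 * k + 1 < v then 0 else 1) =
            m - (n + 1) / 2 := by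
        rw [card_image_of_injOn, card_range]
        intro a ha b hb hab
        simp only [coe_range, Set.mem_Iio] at ha hb
        dsimp only at hab
        split_ifs at hab <;> omega
      rw [← this]
      apply card_le_card
      intro c hc
      simp only [pure, mem_image, mem_range, mem_filter, mem_Ico] at hc ⊢
      obtain ⟨k, hk, rfl⟩ := hc
      split_ifs <;> omega
    dsimp only
    omega
  · refine mem_union_left _ (mem_filter.2 ⟨mem_range.2 hv, Or.inl rfl⟩)
  · refine mem_union_left _ (mem_filter.2 ⟨mem_range.2 hv, ?_⟩)
    simp only [id]; omega
  · intro c h3 h4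
    simp only [single, pure, id, mem_union, mem_filter, mem_range, mem_Ico] at h3 h4 ⊢
    omega
  · simp only [id]; omega

/-- The cycle is cut at a vertex with palette `F` and becomes a thread with `n - 1` inner vertices
and `F` at both ends. Taking `a ≠ t` keeps the two edges at the cut vertex distinct. -/
theorem cyclePalettes_of_uniform_long (n m : ℕ) (hm : 3 ≤ m) (h1 : 2 * m < n) :
    CyclePalettes n (2 * m) (fun _ => m) := by
  classical
  have hcF : Fintype.card (Fin (2 * m)) = 2 * m := Fintype.card_fin _
  obtain ⟨F, -, hF⟩ := exists_subset_card_eq (s := (univ : Finset (Fin (2 * m)))) (n := m)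
    (by rw [card_univ]; omega)
  obtain ⟨a, ha, t, ht, hat⟩ := one_lt_card.1 (by omega : 1 < #F)
  obtain ⟨E, e, hE0, hEn, he0, het, hint, hne, hcard⟩ := exists_palettes_thread (n - 1)
    (by omega) (by omega) (fun _ => m) (fun _ _ => by omega) (fun _ _ => by omega) F F a t ha ht
    hF hF
  have hEsucc : ∀ i < n, E (cycSucc n i) = E (i + 1) := by
    intro i hi
    unfold cycSucc
    split_ifs with h
    · rw [hE0, h, ← hEn]; congr 1; omega
    · rfl
  have hmem : ∀ i < n, ∀ c, (c ∈ E i ∧ c ∈ E (i + 1)) ↔ c = e i := by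
    intro i hi c
    rw [← mem_inter, hint i (by omega), mem_singleton]
  refine ⟨fun i => (E i).map Fin.valEmbedding, fun i => e i, fun i hi => ?_⟩
  have hsucc : (fun i => (E i).map Fin.valEmbedding) (cycSucc n i) =
      (E (i + 1)).map Fin.valEmbedding := by
    dsimp only; rw [hEsucc i hi]
  have hm1 := (hmem i hi (e i)).2 rfl
  refine ⟨?_, ?_, ?_, ?_, ?_, ?_⟩
  · intro c hc
    obtain ⟨x, -, rfl⟩ := mem_map.1 hc
    simp
  · rw [card_map, hcard i (by omega)]
  · exact mem_map.2 ⟨e i, hm1.1, rfl⟩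
  · rw [hsucc]; exact mem_map.2 ⟨e i, hm1.2, rfl⟩
  · intro c hc hc'
    rw [hsucc] at hc'
    obtain ⟨x, hx, rfl⟩ := mem_map.1 hc
    obtain ⟨y, hy, hxy⟩ := mem_map.1 hc'
    have : y = x := Fin.valEmbedding.injective hxy
    subst this
    exact congrArg Fin.val ((hmem i hi y).1 ⟨hx, hy⟩)
  · intro h
    have h' : e i = e (cycSucc n i) := Fin.ext h
    unfold cycSucc at h'
    split_ifs at h' with hc
    · rw [he0, show i = n - 1 by omega, het] at h'; exact hat h'.symm
    · exact hne i (by omega) h'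

/-- If some edge has slack, one color can be given to an independent set meeting every other edge,
and removed. If none has slack, degrees alternate, hence are constant since `n` is odd. -/
theorem cyclePalettes_of_odd (n : ℕ) (hn : 3 ≤ n) (ho : Odd n) : ∀ (s : ℕ) (d : ℕ → ℕ), 5 ≤ s →
    s ≤ 2 * n → (∀ i < n, 2 ≤ d i) → (∀ i < n, d i + d (cycSucc n i) ≤ s) →
    CyclePalettes n s d := by
  classical
  intro s
  induction s with
  | zero => intro d h; omega
  | succ s ih =>
    intro d hs hsn hd hds
    have ho' := Nat.odd_iff.1 ho
    by_cases h2 : ∃ v < n, d v = 2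
    · obtain ⟨v, hv, hdv⟩ := h2
      exact cyclePalettes_of_degree_two n _ d hn ho hs hd hds v hv hdv
    push Not at h2
    have hd3 : ∀ i < n, 3 ≤ d i := fun i hi => by have := hd i hi; have := h2 i hi; omega
    by_cases ht : ∃ j < n, d j + d (cycSucc n j) ≤ s
    · obtain ⟨j, hj, hdj⟩ := ht
      have h5 : 5 ≤ s := by
        have := hd3 j hj; have := hd3 _ (cycSucc_lt hj); omega
      -- Alternate vertices of the cycle, with both ends of the slack edge `j` left out.
      let A : ℕ → Prop := fun v => (v < j ∧ (j + v) % 2 = 1) ∨ (j < v ∧ (j + v) % 2 = 0)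
      have hA : ∀ i < n, i ≠ j → A i ∨ A (cycSucc n i) := by
        intro i hi hij
        simp only [A]; unfold cycSucc
        split_ifs <;> omega
      have hA' : ∀ i < n, A i → ¬ A (cycSucc n i) := by
        intro i hi
        simp only [A]; unfold cycSucc
        split_ifs <;> omega
      obtain ⟨E, e, hE⟩ := ih (fun i => if A i then d i - 1 else d i) h5 (by omega)
        (fun i hi => by have := hd3 i hi; split_ifs <;> omega) (fun i hi => by
          have h3 := hd3 i hi
          have h3' := hd3 _ (cycSucc_lt hi)
          have h4 := hds i hi
          by_cases hij : i = j
          · subst hij; split_ifs <;> omega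
          · have := hA i hi hij
            split_ifs <;> omega)
      have hs : ∀ i < n, s ∉ E i := fun i hi h => by simpa using (hE i hi).1 h
      refine ⟨fun i => if A i then insert s (E i) else E i, e, fun i hi => ?_⟩
      have hi' := cycSucc_lt hi
      obtain ⟨p1, p2, p3, p4, p5, p6⟩ := hE i hi
      have hsub : ∀ i, E i ⊆ (if A i then insert s (E i) else E i) := by
        intro i; split_ifs
        · exact subset_insert _ _
        · exact Subset.rfl
      refine ⟨?_, ?_, hsub _ p3, hsub _ p4, ?_, p6⟩
      · have : E i ⊆ range (s + 1) := p1.trans (range_subset_range.2 (Nat.le_succ s))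
        dsimp only
        split_ifs
        · exact insert_subset (by simp) this
        · exact this
      · dsimp only at p2 ⊢
        split_ifs at p2 ⊢
        · rw [card_insert_of_notMem (hs i hi)]; omega
        · exact p2
      · intro c hc hc'
        have hmem : ∀ k, c ∈ (if A k then insert s (E k) else E k) → c ∈ E k ∨ (A k ∧ c = s) := by
          intro k hk
          split_ifs at hk with hAk
          · rcases mem_insert.1 hk with h | h
            · exact Or.inr ⟨hAk, h⟩
            · exact Or.inl h
          · exact Or.inl hk
        rcases hmem _ hc with h | h <;> rcases hmem _ hc' with h' | h'
        · exact p5 c h h'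
        · exact absurd (h'.2 ▸ h) (hs i hi)
        · exact absurd (h.2 ▸ h') (hs _ hi')
        · exact absurd h'.1 (hA' i hi h.1)
    · push Not at ht
      have htight : ∀ i < n, d i + d (cycSucc n i) = s + 1 := fun i hi => by
        have := ht i hi; have := hds i hi; omega
      have halt : ∀ i < n, (i % 2 = 0 → d i = d 0) ∧ (i % 2 = 1 → d i + d 0 = s + 1) := by
        intro i
        induction i with
        | zero => intro _; exact ⟨fun _ => rfl, fun h => by omega⟩
        | succ i ih' =>
          intro hi
          have h1 := ih' (by omega)
          have h2 := htight i (by omega)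
          rw [cycSucc, if_neg (by omega)] at h2
          constructor <;> intro h <;> omega
      have hlast := htight (n - 1) (by omega)
      rw [cycSucc, if_pos (by omega)] at hlast
      have hlast' := (halt (n - 1) (by omega)).1 (by omega)
      have hsd : s + 1 = 2 * d 0 := by omega
      have hconst : ∀ i < n, d i = d 0 := fun i hi => by
        have := halt i hi; omega
      have h3 := hd3 0 (by omega)
      have : CyclePalettes n (2 * d 0) (fun _ => d 0) := by
        by_cases hc : n ≤ 2 * d 0
        · exact cyclePalettes_of_uniform_short n _ hn ho hc (by omega)
        · exact cyclePalettes_of_uniform_long n _ h3 (by omega)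
      rw [hsd]
      obtain ⟨E, e, hE⟩ := this
      exact ⟨E, e, fun i hi => by rw [hconst i hi]; exact hE i hi⟩

/-- A cycle with vertex degrees `d` has a strong edge-coloring with `s ≥ σ + 1` colors when its
length is even or at least `s / 2`. -/
theorem cyclePalettes (n s : ℕ) (d : ℕ → ℕ) (hn : 3 ≤ n) (hs : 5 ≤ s) (ho : Odd n → s ≤ 2 * n)
    (hd : ∀ i < n, 2 ≤ d i) (hds : ∀ i < n, d i + d (cycSucc n i) ≤ s) : CyclePalettes n s d := by
  rcases Nat.even_or_odd n with h | h
  · exact cyclePalettes_of_even n s d hn h (by omega) hd hds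
  · exact cyclePalettes_of_odd n hn h s d hs (ho h) hd hds

end Cycles

/-! ### From palettes to strong colorings -/

section StrongExtension

open Finset

variable {V C : Type*}

/-- A coloring of the edges, given on all unordered pairs, such that edges sharing an end vertex,
or joined by an edge, receive different colors. -/
structure SimpleGraph.StrongPairColoring (G : SimpleGraph V) (c : Sym2 V → C) : Prop where
  star : ∀ ⦃x y z⦄, G.Adj x y → G.Adj x z → c s(x, y) = c s(x, z) → y = z
  joined : ∀ ⦃x y u w⦄, G.Adj x y → G.Adj x u → G.Adj y w → c s(x, u) = c s(y, w) → u = y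

open Classical in
/-- The neighbors of `v`, as a finset. -/
noncomputable def SimpleGraph.nbrs [Fintype V] (G : SimpleGraph V) (v : V) : Finset V :=
  univ.filter (G.Adj v)

@[simp]
theorem SimpleGraph.mem_nbrs [Fintype V] {G : SimpleGraph V} {v w : V} :
    w ∈ G.nbrs v ↔ G.Adj v w := by
  simp [SimpleGraph.nbrs]

theorem SimpleGraph.eq_of_card_nbrs_lt_two [Fintype V] {G : SimpleGraph V} {u v w : V}
    (h : #(G.nbrs u) < 2) (hv : G.Adj u v) (hw : G.Adj u w) : v = w :=
  card_le_one.1 (by omega) v (mem_nbrs.2 hv) w (mem_nbrs.2 hw)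

/-- A coloring away from the leaves at `P`, together with palettes for the vertices of `P`,
extends to a strong coloring. -/
theorem SimpleGraph.exists_strongPairColoring_of_palettes [Fintype V] (G : SimpleGraph V)
    (P : Finset V) (c₁ : Sym2 V → C) (E : V → Finset C)
    (hP : ∀ v ∈ P, 2 ≤ #(G.nbrs v)) (hcard : ∀ v ∈ P, #(G.nbrs v) ≤ #(E v))
    (hmem : ∀ v ∈ P, ∀ w, G.Adj v w → 2 ≤ #(G.nbrs w) → c₁ s(v, w) ∈ E v)
    (hinj : ∀ v ∈ P, ∀ w w', G.Adj v w → G.Adj v w' → 2 ≤ #(G.nbrs w) → 2 ≤ #(G.nbrs w') →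
      c₁ s(v, w) = c₁ s(v, w') → w = w')
    (hin : ∀ v ∈ P, ∀ w ∈ P, G.Adj v w → ∀ c ∈ E v, c ∈ E w → c = c₁ s(v, w))
    (hbd : ∀ v ∈ P, ∀ w ∉ P, G.Adj v w → 2 ≤ #(G.nbrs w) → ∀ u, G.Adj w u →
      c₁ s(w, u) ∈ E v → u = v)
    (hstar : ∀ x ∉ P, ∀ y z, G.Adj x y → G.Adj x z → 2 ≤ #(G.nbrs x) →
      c₁ s(x, y) = c₁ s(x, z) → y = z)
    (hjoin : ∀ x ∉ P, ∀ y ∉ P, G.Adj x y → 2 ≤ #(G.nbrs x) → 2 ≤ #(G.nbrs y) → ∀ u w,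
      G.Adj x u → G.Adj y w → c₁ s(x, u) = c₁ s(y, w) → u = y) :
    ∃ c : Sym2 V → C, G.StrongPairColoring c := by
  classical
  -- The leaves at `v` are injected into the palette minus the colors of the core edges; the palette
  -- has room because it has at least as many colors as `v` has neighbors.
  have hφ : ∀ v, ∃ f : V → C, v ∈ P →
      (∀ u, G.Adj v u → #(G.nbrs u) < 2 → f u ∈ E v ∧
        ∀ w, G.Adj v w → 2 ≤ #(G.nbrs w) → f u ≠ c₁ s(v, w)) ∧
      ∀ u u', G.Adj v u → G.Adj v u' → #(G.nbrs u) < 2 → #(G.nbrs u') < 2 → f u = f u' →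
        u = u' := by
    intro v
    by_cases hv : v ∈ P
    · set core := (G.nbrs v).filter fun w => 2 ≤ #(G.nbrs w) with hcore
      set leaf := (G.nbrs v).filter fun w => ¬ 2 ≤ #(G.nbrs w) with hleaf
      have hsum : #core + #leaf = #(G.nbrs v) := card_filter_add_card_filter_not _
      set K := core.image fun w => c₁ s(v, w) with hK
      have hKc : #K = #core := by
        apply card_image_of_injOn
        intro w hw w' hw' h
        simp only [hcore, coe_filter, Set.mem_ofPred_eq, mem_nbrs] at hw hw'
        exact hinj v hv w w' hw.1 hw'.1 hw.2 hw'.2 h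
      have hKE : K ⊆ E v := by
        intro c hc
        obtain ⟨w, hw, rfl⟩ := mem_image.1 hc
        simp only [hcore, mem_filter, mem_nbrs] at hw
        exact hmem v hv w hw.1 hw.2
      have hle : #leaf ≤ #(E v \ K) := by
        have := card_sdiff_add_card_eq_card hKE
        have := hcard v hv
        omega
      have : Nonempty C := by
        have h1 := hP v hv
        have h2 := hcard v hv
        obtain ⟨c, -⟩ := card_pos.1 (by omega : 0 < #(E v))
        exact ⟨c⟩
      obtain ⟨f, hf1, hf2⟩ := (leaf.finite_toSet).exists_injOn_of_encard_le
        (t := ((E v \ K : Finset C) : Set C)) (by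
          rw [Set.encard_coe_eq_coe_finsetCard, Set.encard_coe_eq_coe_finsetCard]
          exact_mod_cast hle)
      have hlm : ∀ u, G.Adj v u → #(G.nbrs u) < 2 → u ∈ leaf := fun u hu hu' => by
        simp only [hleaf, mem_filter, mem_nbrs]; exact ⟨hu, by omega⟩
      refine ⟨f, fun _ => ⟨fun u hu hu' => ?_, fun u u' h1 h2 h3 h4 h => ?_⟩⟩
      · have : f u ∈ E v \ K := by
          have := hf1 (hlm u hu hu'); simpa using this
        rw [mem_sdiff] at this
        refine ⟨this.1, fun w hw hw' h => this.2 (mem_image.2 ⟨w, ?_, h.symm⟩)⟩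
        simp only [hcore, mem_filter, mem_nbrs]; exact ⟨hw, hw'⟩
      · exact hf2 (hlm u h1 h3) (hlm u' h2 h4) h
    · by_cases hC : Nonempty C
      · exact ⟨fun _ => hC.some, fun h => absurd h hv⟩
      · exact ⟨fun u => (hC ⟨c₁ s(v, u)⟩).elim, fun h => absurd h hv⟩
  choose φ hφ using hφ
  let Q : Sym2 V → V × V → Prop := fun z p =>
    p.1 ∈ P ∧ #(G.nbrs p.2) < 2 ∧ G.Adj p.1 p.2 ∧ z = s(p.1, p.2)
  let c : Sym2 V → C := fun z => if h : ∃ p, Q z p then φ h.choose.1 h.choose.2 else c₁ z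
  have hcl : ∀ v ∈ P, ∀ u, G.Adj v u → #(G.nbrs u) < 2 → c s(v, u) = φ v u := by
    intro v hv u hvu hu
    have h : ∃ p, Q s(v, u) p := ⟨(v, u), hv, hu, hvu, rfl⟩
    have hp := h.choose_spec
    simp only [c, dif_pos h]
    obtain ⟨h1, h2, h3, h4⟩ := hp
    rw [Sym2.eq_iff] at h4
    rcases h4 with h4 | h4
    · rw [← h4.1, ← h4.2]
    · rw [← h4.2] at h1
      have := hP _ h1; omega
  have hcc : ∀ x y, (x ∉ P ∨ 2 ≤ #(G.nbrs y)) → 2 ≤ #(G.nbrs x) → c s(x, y) = c₁ s(x, y) := by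
    intro x y hxy hx
    have h : ¬ ∃ p, Q s(x, y) p := by
      rintro ⟨p, h1, h2, h3, h4⟩
      rw [Sym2.eq_iff] at h4
      rcases h4 with ⟨rfl, rfl⟩ | ⟨rfl, rfl⟩
      · rcases hxy with h | h
        · exact h h1
        · omega
      · omega
    simp only [c, dif_neg h]
  have hcE : ∀ v ∈ P, ∀ u, G.Adj v u → c s(v, u) ∈ E v := by
    intro v hv u hvu
    by_cases hu : 2 ≤ #(G.nbrs u)
    · rw [hcc v u (Or.inr hu) (hP v hv)]; exact hmem v hv u hvu hu
    · rw [hcl v hv u hvu (by omega)]; exact (((hφ v) hv).1 u hvu (by omega)).1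
  have star : ∀ ⦃x y z⦄, G.Adj x y → G.Adj x z → c s(x, y) = c s(x, z) → y = z := by
    intro x y z hxy hxz h
    by_cases hx2 : 2 ≤ #(G.nbrs x)
    swap
    · exact eq_of_card_nbrs_lt_two (by omega) hxy hxz
    by_cases hx : x ∈ P
    · have hφx := (hφ x) hx
      by_cases hy : 2 ≤ #(G.nbrs y) <;> by_cases hz : 2 ≤ #(G.nbrs z)
      · rw [hcc x y (Or.inr hy) hx2, hcc x z (Or.inr hz) hx2] at h
        exact hinj x hx y z hxy hxz hy hz h
      · rw [hcc x y (Or.inr hy) hx2, hcl x hx z hxz (by omega)] at h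
        exact absurd h.symm ((hφx.1 z hxz (by omega)).2 y hxy hy)
      · rw [hcc x z (Or.inr hz) hx2, hcl x hx y hxy (by omega)] at h
        exact absurd h ((hφx.1 y hxy (by omega)).2 z hxz hz)
      · rw [hcl x hx y hxy (by omega), hcl x hx z hxz (by omega)] at h
        exact hφx.2 y z hxy hxz (by omega) (by omega) h
    · rw [hcc x y (Or.inl hx) hx2, hcc x z (Or.inl hx) hx2] at h
      exact hstar x hx y z hxy hxz hx2 h
  refine ⟨c, star, ?_⟩
  intro x y u w hxy hxu hyw h
  have finish : w = x → u = y := by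
    rintro rfl
    rw [Sym2.eq_swap (a := y)] at h
    exact star hxu hxy h
  by_cases hx2 : 2 ≤ #(G.nbrs x)
  swap
  · exact eq_of_card_nbrs_lt_two (by omega) hxu hxy
  by_cases hy2 : 2 ≤ #(G.nbrs y)
  swap
  · exact finish (eq_of_card_nbrs_lt_two (by omega) hyw hxy.symm)
  by_cases hx : x ∈ P <;> by_cases hy : y ∈ P
  · have h1 := hcE x hx u hxu
    have h2 := hcE y hy w hyw
    have h3 := hin x hx y hy hxy _ h1 (h ▸ h2)
    rw [← hcc x y (Or.inr hy2) hx2] at h3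
    exact star hxu hxy h3
  · have h1 := hcE x hx u hxu
    rw [h, hcc y w (Or.inl hy) hy2] at h1
    exact finish (hbd x hx y hy hxy hy2 w hyw h1)
  · have h1 := hcE y hy w hyw
    rw [← h, hcc x u (Or.inl hx) hx2] at h1
    exact hbd y hy x hx hxy.symm hx2 u hxu h1
  · rw [hcc x u (Or.inl hx) hx2, hcc y w (Or.inl hy) hy2] at h
    exact hjoin x hx y hy hxy hx2 hy2 u w hxu hyw h

end StrongExtension

/-! ### Long threads from low density -/

section Discharging

open Finset

variable {V : Type*} [Fintype V]

theorem SimpleGraph.card_darts_filter (H : SimpleGraph V) (S : Finset V)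
    (hS : ∀ x y, H.Adj x y → x ∈ S) (D : Finset (V × V)) (r : V → Prop) [DecidablePred r]
    (hD : ∀ a, a ∈ D ↔ H.Adj a.1 a.2 ∧ r a.1) :
    #D = ∑ v ∈ S.filter r, #(H.nbrs v) := by
  classical
  rw [card_eq_sum_card_fiberwise (f := Prod.fst) (t := S.filter r)]
  · refine sum_congr rfl fun v hv => ?_
    refine card_bij (fun a _ => a.2) ?_ ?_ ?_
    · intro a ha
      simp only [mem_filter, hD] at ha
      rw [mem_nbrs, ← ha.2]; exact ha.1.1
    · intro a ha b hb hab
      simp only [mem_filter] at ha hb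
      exact Prod.ext (ha.2.trans hb.2.symm) hab
    · intro w hw
      refine ⟨(v, w), ?_, rfl⟩
      simp only [mem_filter, hD] at hv ⊢
      exact ⟨⟨mem_nbrs.1 hw, hv.2⟩, trivial⟩
  · intro a ha
    have := (hD a).1 ha
    simp only [coe_filter, Set.mem_ofPred_eq]
    exact ⟨hS _ _ this.1, this.2⟩

/-- A graph of minimum degree two and small average degree has a non-backtracking walk through
`l` consecutive vertices of degree two. -/
theorem SimpleGraph.exists_long_thread (H : SimpleGraph V) (S : Finset V)
    (hS : ∀ x y, H.Adj x y → x ∈ S) (h2 : ∀ v ∈ S, 2 ≤ #(H.nbrs v)) (l : ℕ) (hl : 1 ≤ l)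
    (hdens : (3 * l - 1) * ∑ v ∈ S, #(H.nbrs v) < 6 * l * #S) :
    ∃ p : ℕ → V, (∀ i ≤ l, H.Adj (p i) (p (i + 1))) ∧ (∀ i < l, p i ≠ p (i + 2)) ∧
      ∀ i, 1 ≤ i → i ≤ l → #(H.nbrs (p i)) = 2 := by
  classical
  have hoth : ∀ a : V × V, ∃ w, 2 ≤ #(H.nbrs a.1) → H.Adj a.1 w ∧ w ≠ a.2 := by
    intro a
    by_cases h : 2 ≤ #(H.nbrs a.1)
    · obtain ⟨w, hw, hne⟩ := exists_mem_ne (by omega : 1 < #(H.nbrs a.1)) a.2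
      exact ⟨w, fun _ => ⟨mem_nbrs.1 hw, hne⟩⟩
    · exact ⟨a.1, fun h' => absurd h' h⟩
  choose oth hoth using hoth
  -- Walks backwards through a vertex of degree two. As this is injective on darts leaving such
  -- vertices, at most `#B₀` darts first reach a vertex of degree at least three after a given
  -- number of steps.
  let prev : V × V → V × V := fun a => (oth a, a.1)
  obtain ⟨B₀, hB₀⟩ : ∃ B₀ : Finset (V × V), ∀ a, a ∈ B₀ ↔ H.Adj a.1 a.2 ∧ 3 ≤ #(H.nbrs a.1) :=
    ⟨univ.filter fun a => H.Adj a.1 a.2 ∧ 3 ≤ #(H.nbrs a.1), by simp⟩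
  obtain ⟨A₂, hA₂⟩ : ∃ A₂ : Finset (V × V), ∀ a, a ∈ A₂ ↔ H.Adj a.1 a.2 ∧ #(H.nbrs a.1) = 2 :=
    ⟨univ.filter fun a => H.Adj a.1 a.2 ∧ #(H.nbrs a.1) = 2, by simp⟩
  obtain ⟨B, hBzero, hBsucc⟩ : ∃ B : ℕ → Finset (V × V), B 0 = B₀ ∧
      ∀ k a, a ∈ B (k + 1) ↔ a ∈ A₂ ∧ prev a ∈ B k :=
    ⟨fun k => k.rec B₀ fun _ X => A₂.filter fun a => prev a ∈ X, rfl, fun k a => by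
      simp only [mem_filter]⟩
  have hprevA : ∀ a ∈ A₂, H.Adj (prev a).1 (prev a).2 ∧ (prev a).1 ≠ a.2 := by
    intro a ha
    have := hoth a (by rw [((hA₂ a).1 ha).2])
    exact ⟨this.1.symm, this.2⟩
  have hinj : Set.InjOn prev (A₂ : Set (V × V)) := by
    intro a ha b hb hab
    have ha' := hprevA a ha
    have hb' := hprevA b hb
    simp only [mem_coe, hA₂] at ha hb
    have h1 : a.1 = b.1 := congrArg Prod.snd hab
    refine Prod.ext h1 ?_
    by_contra hne
    have h3 : #({(prev a).1, a.2, b.2} : Finset V) = 3 := by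
      rw [card_insert_of_notMem, card_pair hne]
      simp only [mem_insert, mem_singleton, not_or]
      exact ⟨ha'.2, hab ▸ hb'.2⟩
    have : ({(prev a).1, a.2, b.2} : Finset V) ⊆ H.nbrs a.1 := by
      intro x hx
      simp only [mem_insert, mem_singleton] at hx
      rw [mem_nbrs]
      rcases hx with rfl | rfl | rfl
      · exact ha'.1.symm
      · exact ha.1
      · rw [h1]; exact hb.1
    have := card_le_card this
    omega
  have hBcard : ∀ k, #(B k) ≤ #B₀ := by
    intro k
    induction k with
    | zero => rw [hBzero]
    | succ k ih =>
      refine (card_le_card_of_injOn prev (fun a ha => ((hBsucc k a).1 ha).2) ?_).trans ih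
      exact hinj.mono fun a ha => ((hBsucc k a).1 ha).1
  by_cases hlong : ∃ a ∈ A₂, ∀ j < l - 1, a ∉ B (j + 1)
  · obtain ⟨a, ha, hj⟩ := hlong
    have key : ∀ k, ∀ a ∈ A₂, (∀ j < k, a ∉ B (j + 1)) → ∀ i ≤ k, prev^[i] a ∈ A₂ := by
      intro k
      induction k with
      | zero =>
        intro a ha _ i hi
        rw [Nat.le_zero.1 hi]; exact ha
      | succ k ih =>
        intro a ha hj i hi
        rcases i with _ | i
        · exact ha
        · rw [Function.iterate_succ_apply]
          have hp := hprevA a ha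
          refine ih (prev a) ?_ (fun j hjk hmem => hj (j + 1) (by omega) ?_) i (by omega)
          · rw [hA₂]
            refine ⟨hp.1, ?_⟩
            by_contra hne
            have := h2 _ (hS _ _ hp.1)
            refine hj 0 (by omega) ((hBsucc 0 a).2 ⟨ha, ?_⟩)
            rw [hBzero, hB₀]
            exact ⟨hp.1, by omega⟩
          · exact (hBsucc _ _).2 ⟨ha, hmem⟩
    have hit := key (l - 1) a ha hj
    let p : ℕ → V := fun i => i.casesOn a.2 fun i => (prev^[i] a).1
    have hp0 : ∀ i, (prev^[i] a).2 = p i := by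
      rintro (_ | i)
      · rfl
      · rw [Function.iterate_succ_apply']
    have hadj : ∀ i ≤ l, H.Adj (prev^[i] a).1 (prev^[i] a).2 := by
      rintro (_ | i) hi
      · exact ((hA₂ a).1 ha).1
      · rw [Function.iterate_succ_apply']
        exact (hprevA _ (hit i (by omega))).1
    refine ⟨p, fun i hi => ?_, fun i hi => ?_, ?_⟩
    · rw [← hp0 i]; exact (hadj i hi).symm
    · rw [← hp0 i]
      have := (hprevA _ (hit i (by omega))).2.symm
      rwa [← Function.iterate_succ_apply' prev i a] at this
    · rintro (_ | i) h1 hi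
      · omega
      · exact ((hA₂ _).1 (hit i (by omega))).2
  -- Without a long thread, the `2 * n2` darts from vertices of degree two number at most `(l - 1) *
  -- D`, where `D` is the degree sum over the other vertices. Together with `3 * n3 ≤ D` this
  -- contradicts the density bound.
  · exfalso
    push Not at hlong
    have hsub : A₂ ⊆ (range (l - 1)).biUnion fun j => B (j + 1) := by
      intro a ha
      obtain ⟨j, hj, hm⟩ := hlong a ha
      exact mem_biUnion.2 ⟨j, mem_range.2 hj, hm⟩
    have hle : #A₂ ≤ (l - 1) * #B₀ := by
      refine (card_le_card hsub).trans ?_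
      have := card_biUnion_le_card_mul (range (l - 1)) (fun j => B (j + 1)) #B₀
        fun j _ => hBcard _
      simpa using this
    rw [H.card_darts_filter S hS A₂ (fun v => #(H.nbrs v) = 2) hA₂,
      H.card_darts_filter S hS B₀ (fun v => 3 ≤ #(H.nbrs v)) hB₀] at hle
    have hsplit : ∑ v ∈ S, #(H.nbrs v) = ∑ v ∈ S.filter (fun v => #(H.nbrs v) = 2), #(H.nbrs v) +
        ∑ v ∈ S.filter (fun v => 3 ≤ #(H.nbrs v)), #(H.nbrs v) := by
      rw [← sum_filter_add_sum_filter_not S (fun v => #(H.nbrs v) = 2)]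
      congr 1
      refine sum_congr (filter_congr fun v hv => ?_) fun _ _ => rfl
      have := h2 v hv
      omega
    have hSc : #S = #(S.filter (fun v => #(H.nbrs v) = 2)) +
        #(S.filter (fun v => 3 ≤ #(H.nbrs v))) := by
      rw [← card_filter_add_card_filter_not (s := S) (fun v => #(H.nbrs v) = 2)]
      congr 2
      refine filter_congr fun v hv => ?_
      have := h2 v hv
      omega
    have hn2 : ∑ v ∈ S.filter (fun v => #(H.nbrs v) = 2), #(H.nbrs v) =
        #(S.filter (fun v => #(H.nbrs v) = 2)) * 2 :=
      sum_const_nat fun v hv => (mem_filter.1 hv).2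
    have hn3 : #(S.filter (fun v => 3 ≤ #(H.nbrs v))) * 3 ≤
        ∑ v ∈ S.filter (fun v => 3 ≤ #(H.nbrs v)), #(H.nbrs v) := by
      have := card_nsmul_le_sum (S.filter (fun v => 3 ≤ #(H.nbrs v))) (fun v => #(H.nbrs v)) 3
        fun v hv => (mem_filter.1 hv).2
      simpa using this
    rw [hsplit, hSc, hn2] at hdens
    rw [hn2] at hle
    generalize #(S.filter (fun v => #(H.nbrs v) = 2)) = n2 at *
    generalize #(S.filter (fun v => 3 ≤ #(H.nbrs v))) = n3 at *
    generalize ∑ v ∈ S.filter (fun v => 3 ≤ #(H.nbrs v)), #(H.nbrs v) = D at *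
    obtain ⟨m, rfl⟩ : ∃ m, l = m + 1 := ⟨l - 1, by omega⟩
    rw [show 3 * (m + 1) - 1 = 3 * m + 2 by omega] at hdens
    rw [show m + 1 - 1 = m by omega] at hle
    have := Nat.mul_le_mul_left (m + 1) hn3
    nlinarith

/-- A walk through vertices of degree two closes to a cycle or is a genuine thread. -/
theorem SimpleGraph.cycle_or_thread (H : SimpleGraph V) (l : ℕ) (p : ℕ → V)
    (hadj : ∀ i ≤ l, H.Adj (p i) (p (i + 1))) (hback : ∀ i < l, p i ≠ p (i + 2))
    (h2 : ∀ i, 1 ≤ i → i ≤ l → #(H.nbrs (p i)) = 2) :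
    (∃ (n : ℕ) (q : ℕ → V), 3 ≤ n ∧ (∀ i < n, H.Adj (q i) (q (cycSucc n i))) ∧
      Set.InjOn q (Set.Iio n) ∧ ∀ i < n, #(H.nbrs (q i)) = 2) ∨
    (Set.InjOn p (Set.Icc 1 l) ∧ ∀ i, 1 ≤ i → i ≤ l → p i ≠ p 0 ∧ p i ≠ p (l + 1)) := by
  classical
  -- A shortest return gives the cycle. The bound `m ≤ l` leaves out `p 0 = p (l + 1)`: the two ends
  -- of a thread may coincide.
  by_cases h : ∃ m, 0 < m ∧ m ≤ l ∧ ∃ i, i + m ≤ l + 1 ∧ p i = p (i + m)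
  · left
    obtain ⟨hm0, hml, i, him, hpi⟩ := Nat.find_spec h
    have hmin := fun k => Nat.find_min (m := k) h
    generalize Nat.find h = m at *
    have hm3 : 3 ≤ m := by
      by_contra hlt
      rcases (by omega : m = 1 ∨ m = 2) with rfl | rfl
      · exact (hadj i (by omega)).ne hpi
      · exact hback i (by omega) hpi
    refine ⟨m, fun t => p (i + t), hm3, ?_, ?_, ?_⟩
    · intro t ht
      have := hadj (i + t) (by omega)
      unfold cycSucc
      dsimp only
      split_ifs with hc
      · rw [add_zero, hpi, ← hc]; exact this
      · exact this
    · have hlt : ∀ t t', t < t' → t' < m → p (i + t) ≠ p (i + t') := by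
        intro t t' h1 h3 heq
        refine hmin (t' - t) (by omega) ⟨by omega, by omega, i + t, by omega, ?_⟩
        rw [heq]; congr 1; omega
      intro t ht t' ht' heq
      simp only [Set.mem_Iio] at ht ht'
      rcases lt_trichotomy t t' with h1 | h1 | h1
      · exact absurd heq (hlt _ _ h1 ht')
      · exact h1
      · exact absurd heq.symm (hlt _ _ h1 ht)
    · intro t ht
      by_cases h0 : i + t = 0
      · have : i = 0 := by omega
        dsimp only
        rw [show i + t = i by omega, hpi]
        exact h2 _ (by omega) (by omega)
      · exact h2 _ (by omega) (by omega)
  · right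
    push Not at h
    have hlt : ∀ t t', t < t' → t' ≤ l + 1 → t' - t ≤ l → p t ≠ p t' := by
      intro t t' h1 h3 h4 heq
      refine h (t' - t) (by omega) h4 t (by omega) ?_
      rw [heq]; congr 1; omega
    refine ⟨?_, fun i h1 h3 => ⟨(hlt 0 i (by omega) (by omega) (by omega)).symm,
      hlt i (l + 1) (by omega) le_rfl (by omega)⟩⟩
    intro t ht t' ht' heq
    simp only [Set.mem_Icc] at ht ht'
    rcases lt_trichotomy t t' with h1 | h1 | h1
    · exact absurd heq (hlt _ _ h1 (by omega) (by omega))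
    · exact h1
    · exact absurd heq.symm (hlt _ _ h1 (by omega) (by omega))

end Discharging

/-! ### The induction over subgraphs -/

section StrongColoring

open Finset

variable {V : Type*} [Fintype V]

namespace SimpleGraph

/-- The degree, odd cycle and density conditions that allow a strong coloring with `s` colors. -/
structure StronglySparse (G : SimpleGraph V) (s l : ℕ) : Prop where
  degree : ∀ ⦃x y⦄, G.Adj x y → #(G.nbrs x) + #(G.nbrs y) ≤ s
  oddCycle : ∀ (n : ℕ) (q : ℕ → V), 3 ≤ n → Odd n → (∀ i < n, G.Adj (q i) (q (cycSucc n i))) →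
    Set.InjOn q (Set.Iio n) → s ≤ 2 * n
  density : ∀ S : Finset V, S.Nonempty → ∀ d : V → ℕ,
    (∀ v ∈ S, ∃ T ⊆ S, T ⊆ G.nbrs v ∧ d v = #T) → (3 * l - 1) * ∑ v ∈ S, d v < 6 * l * #S

theorem nbrs_mono {G G' : SimpleGraph V} (h : G' ≤ G) (v : V) : G'.nbrs v ⊆ G.nbrs v :=
  fun _ hw => mem_nbrs.2 (h (mem_nbrs.1 hw))

/-- The induction requires `s` not to follow σ down to subgraphs, and the density condition to allow
any neighbor subsets inside `S`. -/
theorem StronglySparse.mono {G G' : SimpleGraph V} {s l : ℕ} (hG : G.StronglySparse s l)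
    (h : G' ≤ G) : G'.StronglySparse s l where
  degree x y hxy := (add_le_add (card_le_card (nbrs_mono h x)) (card_le_card (nbrs_mono h y))).trans
    (hG.degree (h hxy))
  oddCycle n q hn ho hq := hG.oddCycle n q hn ho fun i hi => h (hq i hi)
  density S hS d hd := hG.density S hS d fun v hv => by
    obtain ⟨T, h1, h2, h3⟩ := hd v hv
    exact ⟨T, h1, h2.trans (nbrs_mono h v), h3⟩

/-- The edges between vertices of degree at least two. -/
def core (G : SimpleGraph V) : SimpleGraph V where
  Adj x y := G.Adj x y ∧ 2 ≤ #(G.nbrs x) ∧ 2 ≤ #(G.nbrs y)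
  symm := ⟨fun _ _ h => ⟨h.1.symm, h.2.2, h.2.1⟩⟩
  loopless := ⟨fun _ h => h.1.ne rfl⟩

/-- `G` without the edges inside `P` and those joining `P` to leaves. -/
def detach (G : SimpleGraph V) (P : Finset V) : SimpleGraph V where
  Adj x y := G.Adj x y ∧ (x ∈ P → y ∉ P ∧ 2 ≤ #(G.nbrs y)) ∧ (y ∈ P → x ∉ P ∧ 2 ≤ #(G.nbrs x))
  symm := ⟨fun _ _ h => ⟨h.1.symm, h.2.2, h.2.1⟩⟩
  loopless := ⟨fun _ h => h.1.ne rfl⟩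

theorem detach_le (G : SimpleGraph V) (P : Finset V) : G.detach P ≤ G := fun _ _ h => h.1

theorem detach_lt {G : SimpleGraph V} {P : Finset V} {x y : V} (h : G.Adj x y)
    (h' : ¬ (G.detach P).Adj x y) : G.detach P < G :=
  lt_of_le_of_ne (detach_le G P) fun heq => h' (heq.ge h)

theorem detach_adj_of_notMem {G : SimpleGraph V} {P : Finset V} {x y : V} (h : G.Adj x y)
    (hx : x ∉ P) (hx2 : 2 ≤ #(G.nbrs x)) : (G.detach P).Adj x y :=
  ⟨h, fun h' => absurd h' hx, fun _ => ⟨hx, hx2⟩⟩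

theorem eq_or_eq_of_card_nbrs_eq_two {H : SimpleGraph V} {v a b w : V} (h : #(H.nbrs v) = 2)
    (ha : H.Adj v a) (hb : H.Adj v b) (hab : a ≠ b) (hw : H.Adj v w) : w = a ∨ w = b := by
  classical
  have : ({a, b} : Finset V) = H.nbrs v := by
    apply eq_of_subset_of_card_le
    · intro x hx
      simp only [mem_insert, mem_singleton] at hx
      rcases hx with rfl | rfl <;> simpa
    · rw [h, card_pair hab]
  have hw' : w ∈ ({a, b} : Finset V) := this ▸ mem_nbrs.2 hw
  simpa using hw'

/-- A vertex of degree at least two outside `P` keeps all its edges in `G.detach P`, so its palette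
is already fixed and every condition away from `P` is inherited from `c'`. -/
theorem exists_strongPairColoring_of_detach {C : Type*} (G : SimpleGraph V) (P : Finset V)
    (c' c₁ : Sym2 V → C) (hc' : (G.detach P).StrongPairColoring c') (E : V → Finset C)
    (hagree : ∀ x y, (G.detach P).Adj x y → c₁ s(x, y) = c' s(x, y))
    (hP : ∀ v ∈ P, 2 ≤ #(G.nbrs v)) (hcard : ∀ v ∈ P, #(G.nbrs v) ≤ #(E v))
    (hmem : ∀ v ∈ P, ∀ w, G.core.Adj v w → c₁ s(v, w) ∈ E v)
    (hinj : ∀ v ∈ P, ∀ w w', G.core.Adj v w → G.core.Adj v w' → c₁ s(v, w) = c₁ s(v, w') → w = w')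
    (hin : ∀ v ∈ P, ∀ w ∈ P, G.core.Adj v w → ∀ c ∈ E v, c ∈ E w → c = c₁ s(v, w))
    (hbd : ∀ v ∈ P, ∀ w ∉ P, G.core.Adj v w → ∀ u, G.Adj w u → c' s(w, u) ∈ E v →
      c' s(w, u) = c' s(w, v)) :
    ∃ c : Sym2 V → C, G.StrongPairColoring c := by
  refine G.exists_strongPairColoring_of_palettes P c₁ E hP hcard
    (fun v hv w hvw hw => hmem v hv w ⟨hvw, hP v hv, hw⟩)
    (fun v hv w w' h1 h2 h3 h4 => hinj v hv w w' ⟨h1, hP v hv, h3⟩ ⟨h2, hP v hv, h4⟩)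
    (fun v hv w hw hvw => hin v hv w hw ⟨hvw, hP v hv, hP w hw⟩) ?_ ?_ ?_
  · intro v hv w hw hvw hw2 u hwu hc
    have h1 := detach_adj_of_notMem hwu hw hw2
    rw [hagree _ _ h1] at hc
    exact hc'.star h1 (detach_adj_of_notMem hvw.symm hw hw2)
      (hbd v hv w hw ⟨hvw, hP v hv, hw2⟩ u hwu hc)
  · intro x hx y z hxy hxz hx2 h
    have h1 := detach_adj_of_notMem hxy hx hx2
    have h2 := detach_adj_of_notMem hxz hx hx2
    rw [hagree _ _ h1, hagree _ _ h2] at h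
    exact hc'.star h1 h2 h
  · intro x hx y hy hxy hx2 hy2 u w hxu hyw h
    have h1 := detach_adj_of_notMem hxu hx hx2
    have h2 := detach_adj_of_notMem hyw hy hy2
    rw [hagree _ _ h1, hagree _ _ h2] at h
    exact hc'.joined (detach_adj_of_notMem hxy hx hx2) h1 h2 h

/-- With a core neighbor `w`, the palette of `v` is the color of `vw` together with all colors
missing at `w`; these are enough since deg v + deg w ≤ s. -/
theorem exists_strongPairColoring_of_core_degree_le_one {s : ℕ} (G : SimpleGraph V) {l : ℕ}
    (hG : G.StronglySparse s l) (v : V) (hv : 2 ≤ #(G.nbrs v)) (hcore : #(G.core.nbrs v) ≤ 1)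
    (c' : Sym2 V → Fin s) (hc' : (G.detach {v}).StrongPairColoring c') :
    ∃ c : Sym2 V → Fin s, G.StrongPairColoring c := by
  classical
  have huniq : ∀ w w', G.core.Adj v w → G.core.Adj v w' → w = w' := fun w w' h h' =>
    card_le_one.1 hcore w (mem_nbrs.2 h) w' (mem_nbrs.2 h')
  have hE : ∃ E : Finset (Fin s), #(G.nbrs v) ≤ #E ∧ ∀ w, G.core.Adj v w → c' s(v, w) ∈ E ∧
      ∀ u, G.Adj w u → c' s(w, u) ∈ E → c' s(w, u) = c' s(w, v) := by
    by_cases h : ∃ w, G.core.Adj v w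
    · obtain ⟨w, hw⟩ := h
      let K := (G.nbrs w).image fun u => c' s(w, u)
      have hK : #K ≤ #(G.nbrs w) := card_image_le
      have hs := hG.degree hw.1
      refine ⟨insert (c' s(v, w)) Kᶜ, ?_, fun w' hw' => ?_⟩
      · have h1 : #Kᶜ = s - #K := by rw [card_compl, Fintype.card_fin]
        have h2 := card_le_card (subset_insert (c' s(v, w)) Kᶜ)
        omega
      · rw [← huniq w w' hw hw']
        refine ⟨mem_insert_self _ _, fun u hu hc => ?_⟩
        rcases mem_insert.1 hc with h | h
        · rw [h, Sym2.eq_swap]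
        · exact absurd (mem_image.2 ⟨u, mem_nbrs.2 hu, rfl⟩) (mem_compl.1 h)
    · refine ⟨univ, ?_, fun w hw => absurd ⟨w, hw⟩ h⟩
      obtain ⟨y, hy⟩ := card_pos.1 (by omega : 0 < #(G.nbrs v))
      have := hG.degree (mem_nbrs.1 hy)
      rw [card_univ, Fintype.card_fin]; omega
  obtain ⟨E, hEc, hE⟩ := hE
  refine exists_strongPairColoring_of_detach G {v} c' c' hc' (fun _ => E) (fun _ _ _ => rfl)
    ?_ ?_ ?_ ?_ ?_ ?_ <;> intro x hx <;> rw [mem_singleton] at hx <;> subst hx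
  · exact hv
  · exact hEc
  · exact fun w hw => (hE w hw).1
  · exact fun w w' h h' _ => huniq w w' h h'
  · intro w hw h; rw [mem_singleton] at hw; exact absurd hw.symm h.1.ne
  · exact fun w _ h => (hE w h).2

/-- The cycle is a component of the core, so no core edge leaves `P` and the boundary condition is
void. -/
theorem exists_strongPairColoring_of_cycle {s : ℕ} (G : SimpleGraph V) {l : ℕ}
    (hG : G.StronglySparse s l) (hs : 5 ≤ s) (n : ℕ) (q : ℕ → V) (hn : 3 ≤ n)
    (hq : ∀ i < n, G.core.Adj (q i) (q (cycSucc n i))) (hqi : Set.InjOn q (Set.Iio n))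
    (hq2 : ∀ i < n, #(G.core.nbrs (q i)) = 2)
    (hind : ∀ G' < G, ∃ c : Sym2 V → Fin s, G'.StrongPairColoring c) :
    ∃ c : Sym2 V → Fin s, G.StrongPairColoring c := by
  classical
  obtain ⟨E₀, e₀, hE₀⟩ := cyclePalettes n s (fun i => #(G.nbrs (q i))) hn hs
    (fun ho => hG.oddCycle n q hn ho (fun i hi => (hq i hi).1) hqi) (fun i hi => (hq i hi).2.1)
    (fun i hi => hG.degree (hq i hi).1)
  let P : Finset V := (range n).image q
  have hPq : ∀ i < n, q i ∈ P := fun i hi => mem_image_of_mem q (mem_range.2 hi)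
  have hPe : ∀ v ∈ P, ∃ i < n, q i = v := fun v hv => by
    obtain ⟨i, hi, h⟩ := mem_image.1 hv; exact ⟨i, mem_range.1 hi, h⟩
  obtain ⟨idx, hidx⟩ : ∃ idx : V → ℕ, ∀ i < n, idx (q i) = i :=
    ⟨Function.invFunOn q (Set.Iio n), fun i hi => hqi.leftInvOn_invFunOn hi⟩
  have hinj : ∀ i < n, ∀ j < n, q i = q j → i = j := fun i hi j hj h => hqi hi hj h
  have h0 := hq 0 (by omega)
  obtain ⟨c', hc'⟩ := hind (G.detach P) (detach_lt h0.1 fun h =>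
    (h.2.1 (hPq 0 (by omega))).1 (hPq _ (cycSucc_lt (by omega))))
  have hlt : ∀ i < n, e₀ i < s := fun i hi => mem_range.1 ((hE₀ i hi).1 (hE₀ i hi).2.2.1)
  let e : ℕ → Fin s := fun i => if h : e₀ i < s then ⟨e₀ i, h⟩ else ⟨0, by omega⟩
  have he : ∀ i < n, (e i : ℕ) = e₀ i := fun i hi => by simp only [e, dif_pos (hlt i hi)]
  let E : V → Finset (Fin s) := fun v => univ.filter fun c => (c : ℕ) ∈ E₀ (idx v)
  have hE : ∀ i < n, ∀ c, c ∈ E (q i) ↔ (c : ℕ) ∈ E₀ i := by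
    intro i hi c; simp [E, hidx i hi]
  let c₁ : Sym2 V → Fin s := fun z =>
    if h : ∃ i < n, z = s(q i, q (cycSucc n i)) then e h.choose else c' z
  have hc₁ : ∀ i < n, c₁ s(q i, q (cycSucc n i)) = e i := by
    intro i hi
    have h : ∃ j < n, s(q i, q (cycSucc n i)) = s(q j, q (cycSucc n j)) := ⟨i, hi, rfl⟩
    obtain ⟨h1, h2⟩ := h.choose_spec
    simp only [c₁, dif_pos h]
    generalize h.choose = j at *
    rw [Sym2.eq_iff] at h2
    have hci := cycSucc_lt hi
    have hcj := cycSucc_lt h1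
    rcases h2 with ⟨h2, -⟩ | ⟨h2, h3⟩
    · rw [hinj i hi j h1 h2]
    · have h4 := hinj i hi _ hcj h2
      have h5 := hinj _ hci j h1 h3
      unfold cycSucc at h4 h5
      split_ifs at h4 h5 <;> omega
  have hpl : ∀ {i}, i < n → cycPred n i < n := by
    intro i hi; unfold cycPred; split_ifs <;> omega
  have hps : ∀ {i}, i < n → cycSucc n (cycPred n i) = i := by
    intro i hi
    unfold cycPred cycSucc
    by_cases h : i = 0
    · rw [if_pos h, if_pos (by omega), h]
    · rw [if_neg h, if_neg (by omega)]; omega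
  have hnb : ∀ i < n, ∀ w, G.core.Adj (q i) w → w = q (cycSucc n i) ∨ w = q (cycPred n i) := by
    intro i hi w hw
    refine eq_or_eq_of_card_nbrs_eq_two (hq2 i hi) (hq i hi) ?_ ?_ hw
    · have := hq _ (hpl hi)
      rw [hps hi] at this
      exact this.symm
    · intro h
      have := hinj _ (cycSucc_lt hi) _ (hpl hi) h
      unfold cycSucc cycPred at this
      split_ifs at this <;> omega
  have hc₁' : ∀ i < n, c₁ s(q i, q (cycPred n i)) = e (cycPred n i) := by
    intro i hi
    rw [← hc₁ _ (hpl hi), hps hi, Sym2.eq_swap]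
  have hnP : ∀ v ∈ P, ∀ w, G.core.Adj v w → w ∈ P := by
    intro v hv w hw
    obtain ⟨i, hi, rfl⟩ := hPe v hv
    rcases hnb i hi w hw with rfl | rfl
    · exact hPq _ (cycSucc_lt hi)
    · exact hPq _ (hpl hi)
  have hsucc : ∀ i < n, ∀ c, c ∈ E (q i) → c ∈ E (q (cycSucc n i)) → c = e i := by
    intro i hi c h1 h2
    rw [hE _ hi] at h1
    rw [hE _ (cycSucc_lt hi)] at h2
    exact Fin.ext (((hE₀ i hi).2.2.2.2.1 c h1 h2).trans (he i hi).symm)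
  have hne : ∀ i < n, e (cycSucc n i) ≠ e (cycPred n (cycSucc n i)) := by
    intro i hi h
    rw [cycPred_cycSucc hi] at h
    have := congrArg Fin.val h
    rw [he _ (cycSucc_lt hi), he i hi] at this
    exact (hE₀ i hi).2.2.2.2.2 this.symm
  refine exists_strongPairColoring_of_detach G P c' c₁ hc' E ?_ ?_ ?_ ?_ ?_ ?_ ?_
  · intro x y hxy
    have h : ¬ ∃ i < n, s(x, y) = s(q i, q (cycSucc n i)) := by
      rintro ⟨i, hi, h⟩
      have h1 := hPq i hi
      have h2 := hPq _ (cycSucc_lt hi)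
      rw [Sym2.eq_iff] at h
      rcases h with ⟨rfl, rfl⟩ | ⟨rfl, rfl⟩
      · exact (hxy.2.1 h1).1 h2
      · exact (hxy.2.1 h2).1 h1
    simp only [c₁, dif_neg h]
  · intro v hv
    obtain ⟨i, hi, rfl⟩ := hPe v hv
    exact (hq i hi).2.1
  · intro v hv
    obtain ⟨i, hi, rfl⟩ := hPe v hv
    refine (hE₀ i hi).2.1.trans ?_
    have : E₀ i ⊆ (E (q i)).image Fin.val := by
      intro c hc
      have hcs := mem_range.1 ((hE₀ i hi).1 hc)
      exact mem_image.2 ⟨⟨c, hcs⟩, (hE i hi _).2 hc, rfl⟩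
    exact (card_le_card this).trans card_image_le
  · intro v hv w hw
    obtain ⟨i, hi, rfl⟩ := hPe v hv
    rcases hnb i hi w hw with rfl | rfl
    · rw [hc₁ i hi, hE i hi, he i hi]; exact (hE₀ i hi).2.2.1
    · rw [hc₁' i hi, hE i hi, he _ (hpl hi)]
      have := (hE₀ _ (hpl hi)).2.2.2.1
      rwa [hps hi] at this
  · intro v hv w w' hw hw' h
    obtain ⟨i, hi, rfl⟩ := hPe v hv
    have hne' := hne _ (hpl hi)
    rw [hps hi] at hne'
    rcases hnb i hi w hw with rfl | rfl <;> rcases hnb i hi w' hw' with rfl | rfl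
    · rfl
    · rw [hc₁ i hi, hc₁' i hi] at h; exact absurd h hne'
    · rw [hc₁ i hi, hc₁' i hi] at h; exact absurd h.symm hne'
    · rfl
  · intro v hv w _ hvw c hcv hcw
    obtain ⟨i, hi, rfl⟩ := hPe v hv
    rcases hnb i hi w hvw with rfl | rfl
    · rw [hc₁ i hi]; exact hsucc i hi c hcv hcw
    · rw [hc₁' i hi]
      refine hsucc _ (hpl hi) c hcw ?_
      rwa [hps hi]
  · exact fun v hv w hw hvw => absurd (hnP v hv w hvw) hw

/-- The stars of both ends survive detaching, so their palettes, and the colors of the first and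
last thread edges, are read off from `c'`; `exists_palettes_thread` fills in the rest. -/
theorem exists_strongPairColoring_of_thread {s : ℕ} (G : SimpleGraph V) {l : ℕ}
    (hG : G.StronglySparse s l) (hs : 5 ≤ s) (hl : s / 2 + 3 ≤ l) (p : ℕ → V)
    (hp : ∀ i ≤ l, G.core.Adj (p i) (p (i + 1))) (hback : ∀ i < l, p i ≠ p (i + 2))
    (hp2 : ∀ i, 1 ≤ i → i ≤ l → #(G.core.nbrs (p i)) = 2) (hpi : Set.InjOn p (Set.Icc 1 l))
    (hends : ∀ i, 1 ≤ i → i ≤ l → p i ≠ p 0 ∧ p i ≠ p (l + 1))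
    (hind : ∀ G' < G, ∃ c : Sym2 V → Fin s, G'.StrongPairColoring c) :
    ∃ c : Sym2 V → Fin s, G.StrongPairColoring c := by
  classical
  let P : Finset V := (Icc 1 l).image p
  have hPp : ∀ i, 1 ≤ i → i ≤ l → p i ∈ P := fun i h1 h2 =>
    mem_image_of_mem p (mem_Icc.2 ⟨h1, h2⟩)
  have hPe : ∀ v ∈ P, ∃ i, 1 ≤ i ∧ i ≤ l ∧ p i = v := fun v hv => by
    obtain ⟨i, hi, h⟩ := mem_image.1 hv
    rw [mem_Icc] at hi
    exact ⟨i, hi.1, hi.2, h⟩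
  have hP0 : p 0 ∉ P := fun h => by
    obtain ⟨i, h1, h2, h3⟩ := hPe _ h; exact (hends i h1 h2).1 h3
  have hPl : p (l + 1) ∉ P := fun h => by
    obtain ⟨i, h1, h2, h3⟩ := hPe _ h; exact (hends i h1 h2).2 h3
  obtain ⟨idx, hidx⟩ : ∃ idx : V → ℕ, ∀ i, 1 ≤ i → i ≤ l → idx (p i) = i :=
    ⟨Function.invFunOn p (Set.Icc 1 l), fun i h1 h2 => hpi.leftInvOn_invFunOn ⟨h1, h2⟩⟩
  have hdeg : ∀ i ≤ l + 1, 2 ≤ #(G.nbrs (p i)) := by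
    rintro (_ | i) hi
    · exact (hp 0 (by omega)).2.1
    · exact (hp i (by omega)).2.2
  obtain ⟨c', hc'⟩ := hind (G.detach P) (detach_lt (hp 1 (by omega)).1 fun h =>
    (h.2.1 (hPp 1 le_rfl (by omega))).1 (hPp 2 (by omega) (by omega)))
  have hend : ∀ w ∉ P, 2 ≤ #(G.nbrs w) →
      #((G.nbrs w).image fun u => c' s(w, u)) = #(G.nbrs w) := by
    intro w hw hw2
    apply card_image_of_injOn
    intro u hu u' hu' h
    simp only [mem_coe, mem_nbrs] at hu hu'
    exact hc'.star (detach_adj_of_notMem hu hw hw2) (detach_adj_of_notMem hu' hw hw2) h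
  obtain ⟨E, e, hE0, hEl, he0, hel, hint, hne, hcard⟩ := exists_palettes_thread (C := Fin s) l
    (by rwa [Fintype.card_fin]) (by rwa [Fintype.card_fin]) (fun i => #(G.nbrs (p i))) hdeg
    (fun i hi => by rw [Fintype.card_fin]; exact hG.degree (hp i hi).1)
    ((G.nbrs (p 0)).image fun u => c' s(p 0, u))
    ((G.nbrs (p (l + 1))).image fun u => c' s(p (l + 1), u))
    (c' s(p 0, p 1)) (c' s(p (l + 1), p l))
    (mem_image.2 ⟨p 1, mem_nbrs.2 (hp 0 (by omega)).1, rfl⟩)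
    (mem_image.2 ⟨p l, mem_nbrs.2 (hp l le_rfl).1.symm, rfl⟩)
    (hend _ hP0 (hdeg 0 (by omega))) (hend _ hPl (hdeg _ le_rfl))
  have hmem : ∀ i ≤ l, ∀ c, (c ∈ E i ∧ c ∈ E (i + 1)) ↔ c = e i := by
    intro i hi c
    rw [← mem_inter, hint i hi, mem_singleton]
  let c₁ : Sym2 V → Fin s := fun z =>
    if h : ∃ i, (1 ≤ i ∧ i < l) ∧ z = s(p i, p (i + 1)) then e h.choose else c' z
  have hnot : ∀ x y, (x ∉ P ∨ y ∉ P) → c₁ s(x, y) = c' s(x, y) := by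
    intro x y hxy
    have h : ¬ ∃ i, (1 ≤ i ∧ i < l) ∧ s(x, y) = s(p i, p (i + 1)) := by
      rintro ⟨i, hi, h⟩
      have h1 := hPp i hi.1 (by omega)
      have h2 := hPp (i + 1) (by omega) (by omega)
      rw [Sym2.eq_iff] at h
      rcases h with ⟨rfl, rfl⟩ | ⟨rfl, rfl⟩ <;> tauto
    simp only [c₁, dif_neg h]
  have hc₁ : ∀ i ≤ l, c₁ s(p i, p (i + 1)) = e i := by
    intro i hi
    by_cases hi0 : i = 0
    · subst hi0; rw [hnot _ _ (Or.inl hP0), he0]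
    by_cases hil : i = l
    · subst hil; rw [hnot _ _ (Or.inr hPl), hel, Sym2.eq_swap]
    have h : ∃ j, (1 ≤ j ∧ j < l) ∧ s(p i, p (i + 1)) = s(p j, p (j + 1)) :=
      ⟨i, ⟨by omega, by omega⟩, rfl⟩
    obtain ⟨h1, h2⟩ := h.choose_spec
    simp only [c₁, dif_pos h]
    generalize h.choose = j at *
    rw [Sym2.eq_iff] at h2
    have hinj : ∀ a b, 1 ≤ a → a ≤ l → 1 ≤ b → b ≤ l → p a = p b → a = b :=
      fun a b h1 h2 h3 h4 h => hpi ⟨h1, h2⟩ ⟨h3, h4⟩ h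
    rcases h2 with ⟨h2, -⟩ | ⟨h2, h3⟩
    · rw [hinj i j (by omega) (by omega) (by omega) (by omega) h2]
    · have h4 := hinj i (j + 1) (by omega) (by omega) (by omega) (by omega) h2
      have h5 := hinj (i + 1) j (by omega) (by omega) (by omega) (by omega) h3
      omega
  have hnb : ∀ i < l, ∀ w, G.core.Adj (p (i + 1)) w → w = p (i + 2) ∨ w = p i := by
    intro i hi w hw
    exact eq_or_eq_of_card_nbrs_eq_two (hp2 (i + 1) (by omega) (by omega))
      (hp (i + 1) (by omega)) (hp i (by omega)).symm (hback i hi).symm hw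
  have hPe' : ∀ v ∈ P, ∃ i < l, p (i + 1) = v := fun v hv => by
    obtain ⟨i, h1, h2, h3⟩ := hPe v hv
    exact ⟨i - 1, by omega, by rw [← h3]; congr 1; omega⟩
  have hidx' : ∀ i < l, idx (p (i + 1)) = i + 1 := fun i hi => hidx _ (by omega) (by omega)
  have hc₁' : ∀ i < l, c₁ s(p (i + 1), p i) = e i := fun i hi => by
    rw [Sym2.eq_swap, hc₁ i hi.le]
  refine exists_strongPairColoring_of_detach G P c' c₁ hc' (fun v => E (idx v)) ?_ ?_ ?_ ?_ ?_ ?_ ?_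
  · intro x y hxy
    refine hnot x y ?_
    by_cases hx : x ∈ P
    · exact Or.inr (hxy.2.1 hx).1
    · exact Or.inl hx
  · intro v hv
    obtain ⟨i, hi, rfl⟩ := hPe' v hv
    exact hdeg _ (by omega)
  · intro v hv
    obtain ⟨i, hi, rfl⟩ := hPe' v hv
    rw [hidx' i hi, hcard _ (by omega)]
  · intro v hv w hw
    obtain ⟨i, hi, rfl⟩ := hPe' v hv
    rw [hidx' i hi]
    rcases hnb i hi w hw with rfl | rfl
    · rw [hc₁ (i + 1) (by omega)]; exact ((hmem (i + 1) (by omega) _).2 rfl).1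
    · rw [hc₁' i hi]; exact ((hmem i hi.le _).2 rfl).2
  · intro v hv w w' hw hw' h
    obtain ⟨i, hi, rfl⟩ := hPe' v hv
    rcases hnb i hi w hw with rfl | rfl <;> rcases hnb i hi w' hw' with rfl | rfl
    · rfl
    · rw [hc₁ (i + 1) (by omega), hc₁' i hi] at h; exact absurd h.symm (hne i hi)
    · rw [hc₁ (i + 1) (by omega), hc₁' i hi] at h; exact absurd h (hne i hi)
    · rfl
  · intro v hv w hwP hvw c hcv hcw
    obtain ⟨i, hi, rfl⟩ := hPe' v hv
    rw [hidx' i hi] at hcv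
    rcases hnb i hi w hvw with rfl | rfl
    · have hil : i + 1 < l := by
        by_contra hcon
        rw [show i + 2 = l + 1 by omega] at hwP
        exact hPl hwP
      rw [hidx' (i + 1) hil] at hcw
      rw [hc₁ (i + 1) (by omega)]
      exact (hmem (i + 1) (by omega) c).1 ⟨hcv, hcw⟩
    · have hi0 : 1 ≤ i := by
        by_contra hcon
        rw [show i = 0 by omega] at hwP
        exact hP0 hwP
      rw [hidx i hi0 hi.le] at hcw
      rw [hc₁' i hi]
      exact (hmem i hi.le c).1 ⟨hcw, hcv⟩
  · intro v hv w hwP hvw u hu hc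
    obtain ⟨i, hi, rfl⟩ := hPe' v hv
    rw [hidx' i hi] at hc
    rcases hnb i hi w hvw with rfl | rfl
    · have hil : i + 1 = l := by
        by_contra hcon
        exact hwP (hPp (i + 2) (by omega) (by omega))
      subst hil
      rw [← hel]
      refine (hmem (i + 1) le_rfl _).1 ⟨hc, ?_⟩
      rw [hEl]
      exact mem_image.2 ⟨u, mem_nbrs.2 hu, rfl⟩
    · have hi0 : i = 0 := by
        by_contra hcon
        exact hwP (hPp i (by omega) hi.le)
      subst hi0
      rw [zero_add, ← he0]
      refine (hmem 0 (by omega) _).1 ⟨?_, hc⟩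
      rw [hE0]
      exact mem_image.2 ⟨u, mem_nbrs.2 hu, rfl⟩

theorem StronglySparse.exists_strongPairColoring {s l : ℕ} (hs : 5 ≤ s) (hl : s / 2 + 3 ≤ l)
    (G : SimpleGraph V) : G.StronglySparse s l →
    ∃ c : Sym2 V → Fin s, G.StrongPairColoring c := by
  classical
  induction G using WellFoundedLT.induction with
  | ind G ih =>
  intro hG
  have hind : ∀ G' < G, ∃ c : Sym2 V → Fin s, G'.StrongPairColoring c := fun G' h =>
    ih G' h (hG.mono h.le)
  by_cases h0 : ∀ v, #(G.nbrs v) < 2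
  · exact ⟨fun _ => ⟨0, by omega⟩, fun x y z hy hz _ => eq_of_card_nbrs_lt_two (h0 x) hy hz,
      fun x y u w hy hu _ _ => eq_of_card_nbrs_lt_two (h0 x) hu hy⟩
  push Not at h0
  by_cases h1 : ∃ v, 2 ≤ #(G.nbrs v) ∧ #(G.core.nbrs v) ≤ 1
  · obtain ⟨v, hv, hv1⟩ := h1
    -- A leaf at `v` ensures that detaching `v` really removes an edge, so that the induction
    -- applies.
    have : ∃ u, G.Adj v u ∧ #(G.nbrs u) < 2 := by
      by_contra hno
      push Not at hno
      have : G.nbrs v ⊆ G.core.nbrs v := fun u hu => by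
        rw [mem_nbrs] at hu ⊢
        exact ⟨hu, hv, hno u hu⟩
      have := card_le_card this
      omega
    obtain ⟨u, hu, hu2⟩ := this
    obtain ⟨c', hc'⟩ := hind (G.detach {v}) (detach_lt hu fun h => by
      have := (h.2.1 (mem_singleton_self v)).2
      omega)
    exact exists_strongPairColoring_of_core_degree_le_one G hG v hv hv1 c' hc'
  push Not at h1
  obtain ⟨v₀, hv₀⟩ := h0
  let S : Finset V := univ.filter fun v => 2 ≤ #(G.nbrs v)
  have hSm : ∀ v, v ∈ S ↔ 2 ≤ #(G.nbrs v) := fun v => by simp [S]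
  obtain ⟨p, hp, hback, hp2⟩ := G.core.exists_long_thread S (fun x y h => (hSm x).2 h.2.1)
    (fun v hv => by have := h1 v ((hSm v).1 hv); omega) l (by omega)
    (hG.density S ⟨v₀, (hSm v₀).2 hv₀⟩ _ fun v _ => ⟨G.core.nbrs v,
      fun w hw => (hSm w).2 (mem_nbrs.1 hw).2.2,
      fun w hw => mem_nbrs.2 (mem_nbrs.1 hw).1, rfl⟩)
  rcases G.core.cycle_or_thread l p hp hback hp2 with ⟨n, q, hn, hq, hqi, hq2⟩ | ⟨hpi, hends⟩
  · exact exists_strongPairColoring_of_cycle G hG hs n q hn hq hqi hq2 hind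
  · exact exists_strongPairColoring_of_thread G hG hs hl p hp hback hp2 hpi hends hind

end SimpleGraph

end StrongColoring

/-! ### Line-graph distance, σ, odd girth and mad -/

section StrongIndex

open Finset

namespace SimpleGraph

variable {V : Type*}

theorem exists_touching_edge {G : SimpleGraph V} {e f : G.edgeSet}
    (h : G.lineGraph.edist e f ≤ 2) :
    ∃ x y, G.Adj x y ∧ (x ∈ (e : Sym2 V) ∨ y ∈ (e : Sym2 V)) ∧
      (x ∈ (f : Sym2 V) ∨ y ∈ (f : Sym2 V)) := by
  have key : ∀ g : G.edgeSet, (∃ v, v ∈ (g : Sym2 V) ∧ v ∈ (e : Sym2 V)) →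
      (∃ v, v ∈ (g : Sym2 V) ∧ v ∈ (f : Sym2 V)) → ∃ x y, G.Adj x y ∧
        (x ∈ (e : Sym2 V) ∨ y ∈ (e : Sym2 V)) ∧ (x ∈ (f : Sym2 V) ∨ y ∈ (f : Sym2 V)) := by
    rintro ⟨g, hg⟩ ⟨v, h1, h2⟩ ⟨w, h3, h4⟩
    induction g with
    | h x y =>
      refine ⟨x, y, hg, ?_, ?_⟩
      · rcases Sym2.mem_iff.1 h1 with rfl | rfl
        · exact Or.inl h2
        · exact Or.inr h2
      · rcases Sym2.mem_iff.1 h3 with rfl | rfl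
        · exact Or.inl h4
        · exact Or.inr h4
  have hself : ∀ g : G.edgeSet, ∃ v, v ∈ (g : Sym2 V) := by
    rintro ⟨g, hg⟩
    induction g with
    | h x y => exact ⟨x, Sym2.mem_mk_left x y⟩
  have hadj : ∀ {g g' : G.edgeSet}, G.lineGraph.Adj g g' →
      ∃ v, v ∈ (g : Sym2 V) ∧ v ∈ (g' : Sym2 V) := fun h =>
    (lineGraph_adj_iff_exists.1 h).2
  obtain ⟨w, hw⟩ := exists_walk_of_edist_ne_top (ne_top_of_le_ne_top (by decide) h)
  rw [← hw] at h
  have hlen : w.length ≤ 2 := by exact_mod_cast h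
  cases w with
  | nil =>
    obtain ⟨v, hv⟩ := hself e
    exact key e ⟨v, hv, hv⟩ ⟨v, hv, hv⟩
  | cons h1 w =>
    cases w with
    | nil =>
      obtain ⟨v, hv⟩ := hself e
      exact key e ⟨v, hv, hv⟩ (hadj h1)
    | cons h2 w =>
      cases w with
      | nil =>
        obtain ⟨v, hv, hv'⟩ := hadj h1
        exact key _ ⟨v, hv', hv⟩ (hadj h2)
      | cons h3 w => simp only [Walk.length_cons] at hlen; omega

theorem StrongPairColoring.strongEdgeColorable {G : SimpleGraph V} {k : ℕ} {c : Sym2 V → Fin k}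
    (hc : G.StrongPairColoring c) : G.StrongEdgeColorable k := by
  refine ⟨fun e => c e, fun e f hne hd heq => hne (Subtype.ext ?_)⟩
  obtain ⟨x, y, hxy, he, hf⟩ := exists_touching_edge hd
  have hcross : ∀ {x y u w}, G.Adj x y → G.Adj x u → G.Adj y w → c s(x, u) = c s(y, w) →
      s(x, u) = s(y, w) := by
    intro x y u w hxy hxu hyw h
    have hu := hc.joined hxy hxu hyw h
    subst hu
    rw [Sym2.eq_swap] at h ⊢
    rw [hc.star hxy.symm hyw h]
  have hsame : ∀ {x u w}, G.Adj x u → G.Adj x w → c s(x, u) = c s(x, w) → s(x, u) = s(x, w) :=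
    fun h1 h2 h => by rw [hc.star h1 h2 h]
  obtain ⟨e, he'⟩ := e
  obtain ⟨f, hf'⟩ := f
  dsimp only at he hf heq ⊢
  rcases he with ⟨u, rfl⟩ | ⟨u, rfl⟩ <;> rcases hf with ⟨w, rfl⟩ | ⟨w, rfl⟩
  · exact hsame he' hf' heq
  · exact hcross hxy he' hf' heq
  · exact hcross hxy.symm he' hf' heq
  · exact hsame he' hf' heq

theorem card_nbrs [Fintype V] (G : SimpleGraph V) (v : V) [Fintype (G.neighborSet v)] :
    #(G.nbrs v) = G.degree v := by
  rw [← card_neighborFinset_eq_degree]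
  congr 1
  ext w
  simp

theorem degree_add_degree_le_sigma [Fintype V] (G : SimpleGraph V) {x y : V} (h : G.Adj x y) :
    #(G.nbrs x) + #(G.nbrs y) ≤ G.sigma + 1 := by
  classical
  have := le_sup (f := fun e : G.Dart => G.degree e.fst + G.degree e.snd - 1)
    (mem_univ (⟨(x, y), h⟩ : G.Dart))
  rw [card_nbrs, card_nbrs]
  unfold sigma
  have h2 : G.degree x + G.degree y - 1 ≤
    (univ : Finset G.Dart).sup fun e => G.degree e.fst + G.degree e.snd - 1 := this
  have h3 : G.degree x + G.degree y ≤
      ((univ : Finset G.Dart).sup fun e => G.degree e.fst + G.degree e.snd - 1) + 1 := by omega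
  convert h3

theorem exists_adj_sigma [Fintype V] (G : SimpleGraph V) (h : 0 < G.sigma) :
    ∃ x y, G.Adj x y ∧ G.sigma = #(G.nbrs x) + #(G.nbrs y) - 1 := by
  classical
  have hne : (univ : Finset G.Dart).Nonempty := by
    by_contra hno
    rw [not_nonempty_iff_eq_empty] at hno
    unfold sigma at h
    have : (Finset.univ : Finset G.Dart).sup (fun e => G.degree e.fst + G.degree e.snd - 1) = 0 := by
      rw [hno]; rfl
    convert h.ne' this
  obtain ⟨a, -, ha⟩ := exists_mem_eq_sup (univ : Finset G.Dart) hne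
    fun e => G.degree e.fst + G.degree e.snd - 1
  refine ⟨a.fst, a.snd, a.adj, ?_⟩
  rw [card_nbrs, card_nbrs]
  unfold sigma
  convert ha

theorem sigma_le_of_strongEdgeColorable [Fintype V] {G : SimpleGraph V} {k : ℕ}
    (hσ : 0 < G.sigma) (hk : G.StrongEdgeColorable k) : G.sigma ≤ k := by
  classical
  obtain ⟨c, hc⟩ := hk
  obtain ⟨x, y, hxy, hσxy⟩ := G.exists_adj_sigma hσ
  let A : Finset (Sym2 V) := (G.nbrs x).image (fun u => s(x, u)) ∪
    ((G.nbrs y).erase x).image fun u => s(y, u)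
  have hA : ∀ e ∈ A, e ∈ G.edgeSet ∧ (x ∈ e ∨ y ∈ e) := by
    intro e he
    simp only [A, mem_union, mem_image, mem_erase, mem_nbrs] at he
    rcases he with ⟨u, hu, rfl⟩ | ⟨u, ⟨-, hu⟩, rfl⟩
    · exact ⟨hu, Or.inl (Sym2.mem_mk_left _ _)⟩
    · exact ⟨hu, Or.inr (Sym2.mem_mk_left _ _)⟩
  have hcard : #A = #(G.nbrs x) + #(G.nbrs y) - 1 := by
    have hinj : ∀ v : V, Function.Injective fun u => s(v, u) := fun v a b h =>
      Sym2.congr_right.1 h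
    rw [card_union_of_disjoint, card_image_of_injective _ (hinj x),
      card_image_of_injective _ (hinj y), card_erase_of_mem (mem_nbrs.2 hxy.symm)]
    · have := card_pos.2 ⟨x, mem_nbrs.2 hxy.symm⟩
      omega
    · rw [Finset.disjoint_left]
      intro e h1 h2
      simp only [mem_image, mem_erase] at h1 h2
      obtain ⟨u, hu, rfl⟩ := h1
      obtain ⟨w, hw, h⟩ := h2
      rw [Sym2.eq_iff] at h
      rcases h with ⟨h, -⟩ | ⟨-, h⟩
      · exact hxy.ne h.symm
      · exact hw.1 h
  -- Every edge of `A` is within distance one of `g`, hence any two are within distance two.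
  let g : G.edgeSet := ⟨s(x, y), hxy⟩
  have hdist : ∀ e : G.edgeSet, (x ∈ (e : Sym2 V) ∨ y ∈ (e : Sym2 V)) →
      G.lineGraph.edist g e ≤ 1 ∧ G.lineGraph.edist e g ≤ 1 := by
    intro e he
    have : G.lineGraph.edist g e ≤ 1 := by
      rw [edist_le_one_iff_adj_or_eq]
      by_cases hge : g = e
      · exact Or.inr hge
      · left
        refine lineGraph_adj_iff_exists.2 ⟨hge, ?_⟩
        rcases he with he | he
        · exact ⟨x, Sym2.mem_mk_left _ _, he⟩
        · exact ⟨y, Sym2.mem_mk_right _ _, he⟩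
    exact ⟨this, by rwa [edist_comm]⟩
  have hle : Fintype.card A ≤ Fintype.card (Fin k) := by
    refine Fintype.card_le_of_injective (fun a : A => c ⟨a, (hA a a.2).1⟩) ?_
    intro a b hab
    by_contra hne
    refine hc ⟨a, (hA a a.2).1⟩ ⟨b, (hA b b.2).1⟩ (fun h => hne ?_) ?_ hab
    · exact Subtype.ext (Subtype.mk.inj h)
    · refine (G.lineGraph.edist_triangle (v := g)).trans ?_
      have := add_le_add (hdist ⟨a, (hA a a.2).1⟩ (hA a a.2).2).2
        (hdist ⟨b, (hA b b.2).1⟩ (hA b b.2).2).1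
      rwa [one_add_one_eq_two] at this
  rw [Fintype.card_coe, Fintype.card_fin, hcard] at hle
  omega

theorem exists_isCycle_of_cycSucc (G : SimpleGraph V) (n : ℕ) (q : ℕ → V) (hn : 3 ≤ n)
    (hq : ∀ i < n, G.Adj (q i) (q (cycSucc n i))) (hqi : Set.InjOn q (Set.Iio n)) :
    ∃ (a : V) (w : G.Walk a a), w.IsCycle ∧ w.length = n := by
  have hpath : ∀ k < n, ∃ p : G.Walk (q 0) (q k), p.IsPath ∧ p.length = k ∧
      (∀ v ∈ p.support, ∃ j ≤ k, v = q j) ∧ ∀ z ∈ p.edges, ∃ j < k, z = s(q j, q (j + 1)) := by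
    intro k
    induction k with
    | zero =>
      intro _
      exact ⟨Walk.nil, Walk.IsPath.nil, rfl, fun v hv => ⟨0, le_rfl, by simpa using hv⟩, by simp⟩
    | succ k ih =>
      intro hk
      obtain ⟨p, h1, h2, h3, h4⟩ := ih (by omega)
      have hadj : G.Adj (q k) (q (k + 1)) := by
        have := hq k (by omega)
        rwa [cycSucc, if_neg (by omega)] at this
      refine ⟨p.concat hadj, h1.concat (fun hmem => ?_) hadj, ?_, ?_, ?_⟩
      · obtain ⟨j, hj, h⟩ := h3 _ hmem
        have := hqi (Set.mem_Iio.2 hk) (Set.mem_Iio.2 (by omega : j < n)) h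
        omega
      · rw [Walk.length_concat, h2]
      · intro v hv
        simp only [Walk.support_concat, List.mem_append, List.mem_singleton] at hv
        rcases hv with hv | rfl
        · obtain ⟨j, hj, h⟩ := h3 _ hv
          exact ⟨j, by omega, h⟩
        · exact ⟨k + 1, le_rfl, rfl⟩
      · intro z hz
        simp only [Walk.edges_concat, List.concat_eq_append, List.mem_append, List.mem_singleton] at hz
        rcases hz with hz | rfl
        · obtain ⟨j, hj, h⟩ := h4 _ hz
          exact ⟨j, by omega, h⟩
        · exact ⟨k, by omega, rfl⟩
  obtain ⟨p, h1, h2, -, h4⟩ := hpath (n - 1) (by omega)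
  have hadj : G.Adj (q (n - 1)) (q 0) := by
    have := hq (n - 1) (by omega)
    rwa [cycSucc, if_pos (by omega)] at this
  refine ⟨_, Walk.cons hadj p, (Walk.cons_isCycle_iff _ _).2 ⟨h1, fun hmem => ?_⟩, ?_⟩
  · obtain ⟨j, hj, h⟩ := h4 _ hmem
    rw [Sym2.eq_iff] at h
    rcases h with ⟨h, -⟩ | ⟨h, h'⟩
    · have := hqi (Set.mem_Iio.2 (by omega)) (Set.mem_Iio.2 (by omega)) h
      omega
    · have h5 := hqi (Set.mem_Iio.2 (by omega)) (Set.mem_Iio.2 (by omega)) h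
      have h6 := hqi (Set.mem_Iio.2 (by omega)) (Set.mem_Iio.2 (by omega)) h'
      omega
  · rw [Walk.length_cons, h2]; omega

theorem sum_card_le_mad [Fintype V] (G : SimpleGraph V) (S : Finset V) (hS : S.Nonempty)
    (d : V → ℕ) (hd : ∀ v ∈ S, ∃ T ⊆ S, T ⊆ G.nbrs v ∧ d v = #T) :
    ((∑ v ∈ S, d v : ℕ) : ℝ) / #S ≤ G.mad := by
  classical
  let H : G.Subgraph := (⊤ : G.Subgraph).induce S
  have hverts : H.verts = S := rfl
  have hle : ∑ v ∈ S, d v ≤ 2 * H.edgeSet.ncard := by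
    rw [← Subgraph.edgeSet_spanningCoe, ← coe_edgeFinset, Set.ncard_coe_finset,
      ← sum_degrees_eq_twice_card_edges]
    refine (sum_le_sum fun v hv => ?_).trans (sum_le_sum_of_subset (subset_univ S))
    obtain ⟨T, h1, h2, h3⟩ := hd v hv
    rw [h3, ← card_neighborFinset_eq_degree]
    refine card_le_card fun w hw => ?_
    rw [mem_neighborFinset, Subgraph.spanningCoe_adj, Subgraph.induce_adj]
    exact ⟨hv, h1 hw, mem_nbrs.1 (h2 hw)⟩
  have hmad : 2 * (H.edgeSet.ncard : ℝ) / (H.verts.ncard : ℝ) ≤ G.mad :=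
    le_ciSup (f := fun H : {H : G.Subgraph // H.verts.Nonempty} =>
      2 * (H.1.edgeSet.ncard : ℝ) / (H.1.verts.ncard : ℝ)) (Set.finite_range _).bddAbove
      ⟨H, by rw [hverts]; exact hS⟩
  rw [hverts, Set.ncard_coe_finset] at hmad
  refine le_trans ?_ hmad
  gcongr
  exact_mod_cast hle

theorem stronglySparse_of_mad_lt [Fintype V] (G : SimpleGraph V) (l : ℕ) (hl : 1 ≤ l)
    (hodd : ((G.sigma + 1 : ℕ) : ENNReal) / 2 ≤ (G.oddGirth : ENNReal))
    (hmad : G.mad < 2 + 2 / (3 * (l : ℝ) - 1)) : G.StronglySparse (G.sigma + 1) l where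
  degree _ _ h := G.degree_add_degree_le_sigma h
  oddCycle n q hn ho hq hqi := by
    obtain ⟨a, w, hw, hlen⟩ := G.exists_isCycle_of_cycSucc n q hn hq hqi
    have h1 : G.oddGirth ≤ (n : ℕ∞) := by
      have : G.oddGirth ≤ (w.length : ℕ∞) :=
        iInf_le_of_le a (iInf_le_of_le w (iInf_le_of_le ⟨hw, by rwa [hlen]⟩ le_rfl))
      rwa [hlen] at this
    have h2 : ((G.sigma + 1 : ℕ) : ENNReal) / 2 ≤ (n : ENNReal) := by
      refine hodd.trans ?_
      exact_mod_cast ENat.toENNReal_le.2 h1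
    rw [ENNReal.div_le_iff (by norm_num) (by norm_num)] at h2
    have h3 : G.sigma + 1 ≤ n * 2 := by exact_mod_cast h2
    omega
  density S hS d hd := by
    have h1 := (G.sum_card_le_mad S hS d hd).trans_lt hmad
    have hS0 : (0 : ℝ) < #S := by exact_mod_cast card_pos.2 hS
    have hl1 : (1 : ℝ) ≤ l := by exact_mod_cast hl
    have hl0 : (0 : ℝ) < 3 * l - 1 := by linarith
    have h2 : (2 : ℝ) + 2 / (3 * l - 1) = 6 * l / (3 * l - 1) := by
      field_simp; ring
    rw [h2, div_lt_div_iff₀ hS0 hl0] at h1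
    have h3 : ((3 * l - 1 : ℕ) : ℝ) = 3 * l - 1 := by
      rw [Nat.cast_sub (by omega)]; push_cast; ring
    have h4 : (((3 * l - 1) * ∑ v ∈ S, d v : ℕ) : ℝ) < ((6 * l * #S : ℕ) : ℝ) := by
      rw [Nat.cast_mul, h3]; push_cast at h1 ⊢; linarith
    exact_mod_cast h4

end SimpleGraph

end StrongIndex

/-- The only property of the table of thread lengths that the proof of the bounds depends on, apart
from positivity. -/
theorem le_threadLength {s : ℕ} (hs : 5 ≤ s) : s / 2 + 3 ≤ threadLength s := by
  unfold threadLength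
  split_ifs <;> omega

theorem mainTheorem5 {V : Type*} [Fintype V] (G : SimpleGraph V)
    (hσ : 4 ≤ G.sigma)
    (hodd : ((G.sigma + 1 : ℕ) : ENNReal) / 2 ≤ (G.oddGirth : ENNReal))
    (hmad : G.mad < 2 + 2 / (3 * (threadLength (G.sigma + 1) : ℝ) - 1)) :
    (G.sigma : ℕ∞) ≤ G.strongChromaticIndex ∧ G.strongChromaticIndex ≤ (G.sigma : ℕ∞) + 1 := by
  have hl := le_threadLength (show 5 ≤ G.sigma + 1 by omega)
  constructor
  · refine le_iInf₂ fun k hk => ?_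
    exact_mod_cast SimpleGraph.sigma_le_of_strongEdgeColorable (by omega) hk
  · obtain ⟨c, hc⟩ := SimpleGraph.StronglySparse.exists_strongPairColoring (by omega) hl G
      (G.stronglySparse_of_mad_lt _ (by omega) hodd hmad)
    exact iInf₂_le (G.sigma + 1) hc.strongEdgeColorable
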